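/- Let $\mathcal A\subset\mathcal D'(\mathbb R)$ be the space of piecewise smooth functions $\mathbb R\to\mathbb C$ (smooth off a finite set, at whose points all derivatives have finite one-sided limits), regarded as distributions, together with all their distributional derivatives. For $F,G\in\mathcal A$ let $F*G=\lim_{\epsilon\downarrow0}F(x)\cdot G(x+\epsilon)$ in the sense of distributions, where $\cdot$ is the Hörmander product of distributions with disjoint singular supports (locally, the product of a distribution by a smooth function). The order $\operatorname{ord}F$ is the least $n\ge 0$ such that $F$ is the $n$-th distributional derivative of a locally integrable function. Let $H$ be the Heaviside function. Let $\xi_0\in\mathbb R$, $w\in\mathbb C$, let $a_{i\pm},b_{i\pm}\in C^\infty(\mathbb R,\mathbb C)$ and $A_{ij},B_{ij}\in\mathbb C$, and for $i=0,1$ set $$a_i=a_{i-}H(\xi_0-x)+a_{i+}H(x-\xi_0)+\sum_{j=0}^{1}A_{ij}\delta^{(j)}_{\xi_0},\qquad b_i=b_{i-}H(\xi_0-x)+b_{i+}H(x-\xi_0)+\sum_{j=0}^{3}B_{ij}\delta^{(j)}_{\xi_0}.$$ Assume that $a_{0-}(\xi_0)+a_{1+}(\xi_0)\neq0$ and that $a_{0-}(x)+a_{1-}(x)\ne0$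 and $a_{0+}(x)+a_{1+}(x)\neq0$ for all $x\in\mathbb R$. Consider the equation, for $\phi\in\mathcal A$, $$\sum_{i=0}^{2}\binom2i\left(a_0^{(i)}*\phi^{(4-i)}+\phi^{(4-i)}*a_1^{(i)}\right)-w^2\left(b_0*\phi+\phi*b_1\right)=0.\qquad(\ast)$$ (i) If $\operatorname{ord}a_i\le1$ and $\operatorname{ord}b_i\le3$ for $i=0,1$, then every solution $\phi\in\mathcal A$ of $(\ast)$ is (the regular distribution of) a continuous function on $\mathbb R$. (ii) If $\operatorname{ord}a_i=0$ and $\operatorname{ord}b_i\le2$ for $i=0,1$, then every solution $\phi\in\mathcal A$ of $(\ast)$ is (the regular distribution of) a continuously differentiable function on $\mathbb R$. -/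

import Mathlib

open scoped Distributions ContDiff Topology

noncomputable section

namespace BeamDist

/-- Test functions on `ℝ`: smooth, compactly supported, complex valued. -/
abbrev Test : Type := 𝓓((⊤ : TopologicalSpace.Opens ℝ), ℂ)

/-- Schwartz distributions on `ℝ`: continuous `ℂ`-linear functionals on test functions. -/
abbrev Distr : Type := Test →L[ℂ] ℂ

/-- The distributional derivative `⟨T', t⟩ = -⟨T, t'⟩`. -/
def D (T : Distr) : Distr :=
  -(T ∘L TestFunction.lineDerivCLM ℂ (1 : ℝ))

/-- The Dirac measure at `x`. -/
def dirac (x : ℝ) : Distr where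
  toFun t := t x
  map_add' _ _ := rfl
  map_smul' _ _ := rfl
  cont := continuous_eval_const _

/-- The distribution `t ↦ ∫ t f` associated with a locally integrable function `f`. -/
def regular (f : ℝ → ℂ) : Distr :=
  TestFunction.integralAgainstBilinCLM (ContinuousLinearMap.mul ℂ ℂ) MeasureTheory.volume f

/-- The multiplication of test functions by a smooth function `g`. -/
def mulTest (g : ℝ → ℂ) (hg : ContDiff ℝ ∞ g) : Test →L[ℂ] Test :=
  TestFunction.limitCLM ℂ
    (fun t ↦ ⟨fun x ↦ t x * g x, t.contDiff.mul hg, t.hasCompactSupport.mul_right,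
      fun _ _ ↦ trivial⟩)
    (fun K K_sub ↦ TestFunction.ofSupportedInCLM ℂ K_sub ∘L
      ContDiffMapSupportedIn.bilinLeftCLM (ContinuousLinearMap.mul ℂ ℂ) hg)
    (fun _ _ _ ↦ by ext; simp)

/-- The dual product of a smooth function and a distribution: `⟨g T, t⟩ = ⟨T, g t⟩`. -/
def smoothMul (g : ℝ → ℂ) (hg : ContDiff ℝ ∞ g) (T : Distr) : Distr :=
  T ∘L mulTest g hg

/-- The translation of test functions `t ↦ t(· - ε)`. -/
def shiftTest (ε : ℝ) : Test →L[ℂ] Test :=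
  TestFunction.limitCLM ℂ
    (fun t ↦ ⟨fun x ↦ t (x - ε), t.contDiff.comp (contDiff_id.sub contDiff_const),
      t.hasCompactSupport.comp_homeomorph (Homeomorph.subRight ε), fun _ _ ↦ trivial⟩)
    (fun K _ ↦ TestFunction.ofSupportedInCLM ℂ
        (K := K.map (fun x ↦ x + ε) (continuous_add_const ε)) (fun _ _ ↦ trivial) ∘L
      ContDiffMapSupportedIn.mkCLM ℂ (fun t x ↦ t (x - ε))
        (fun _ _ _ ↦ rfl) (fun _ _ _ ↦ rfl)
        (fun t ↦ t.contDiff.comp (contDiff_id.sub contDiff_const))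
        (fun t x hx ↦ t.zero_on_compl (fun h ↦ hx ⟨x - ε, h, sub_add_cancel x ε⟩))
        (fun i hi ↦ ⟨{i}, 1, zero_le_one, fun t x _ ↦ by
          rw [iteratedFDeriv_comp_sub]
          simpa using ContDiffMapSupportedIn.norm_iteratedFDeriv_apply_le_seminorm ℂ hi⟩))
    (fun _ _ _ ↦ rfl)

/-- The translated distribution `T(x + ε)`: `⟨T(x + ε), t(x)⟩ = ⟨T, t(x - ε)⟩`. -/
def shift (ε : ℝ) (T : Distr) : Distr :=
  T ∘L shiftTest ε

/-- `f` is piecewise smooth: smooth off a finite set, at whose points `f` and all its derivatives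
have finite one-sided limits. -/
def PiecewiseSmooth (f : ℝ → ℂ) : Prop :=
  ∃ S : Finset ℝ, ContDiffOn ℝ ∞ f (S : Set ℝ)ᶜ ∧
    ∀ x ∈ S, ∀ n : ℕ,
      (∃ l : ℂ, Filter.Tendsto (iteratedDeriv n f) (𝓝[<] x) (𝓝 l)) ∧
      (∃ r : ℂ, Filter.Tendsto (iteratedDeriv n f) (𝓝[>] x) (𝓝 r))

/-- The space `𝒜`: piecewise smooth functions, regarded as distributions, together with all their
distributional derivatives. -/
def InA (T : Distr) : Prop :=
  ∃ (f : ℝ → ℂ) (n : ℕ), PiecewiseSmooth f ∧ T = D^[n] (regular f)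

/-- The order of a distribution: the least `n` such that `T` is the `n`-th distributional
derivative of a regular distribution (`⊤` if there is none). -/
def ord (T : Distr) : ℕ∞ :=
  ⨅ (n : ℕ) (_ : ∃ f : ℝ → ℂ, MeasureTheory.LocallyIntegrable f ∧ T = D^[n] (regular f)), (n : ℕ∞)

/-- `F` and `G` have the same restriction to the open set `U`. -/
def EqOnOpen (U : Set ℝ) (F G : Distr) : Prop :=
  ∀ t : Test, tsupport t ⊆ U → F t = G t

/-- `P` is the Hörmander product of `F` and `G`: each point has an open neighbourhood `U` on which
one of the factors is a smooth function `g`, and on which `P` is the dual product of `g` and the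
other factor. (Shrinking `U`, one may take `g` to be smooth on all of `ℝ`.) -/
def IsHormanderProd (F G P : Distr) : Prop :=
  ∀ x : ℝ, ∃ U : Set ℝ, IsOpen U ∧ x ∈ U ∧ ∃ (g : ℝ → ℂ) (hg : ContDiff ℝ ∞ g),
    (EqOnOpen U F (regular g) ∧ EqOnOpen U P (smoothMul g hg G)) ∨
    (EqOnOpen U G (regular g) ∧ EqOnOpen U P (smoothMul g hg F))

/-- `P = lim_{ε ↓ 0} F(x) · G(x + ε)` in the sense of distributions, where the Hörmander product
`F(x) · G(x + ε)` is defined for all sufficiently small `ε > 0`. -/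
def IsStarProd (F G P : Distr) : Prop :=
  ∃ Q : ℝ → Distr, (∀ᶠ ε in 𝓝[>] (0 : ℝ), IsHormanderProd F (shift ε G) (Q ε)) ∧
    ∀ t : Test, Filter.Tendsto (fun ε ↦ Q ε t) (𝓝[>] (0 : ℝ)) (𝓝 (P t))

open Classical in
/-- The product `F * G = lim_{ε ↓ 0} F(x) · G(x + ε)`; it exists for all `F`, `G` in `𝒜`, and is
`0` by convention if it does not exist. -/
def starProd (F G : Distr) : Distr :=
  if h : ∃ P, IsStarProd F G P then h.choose else 0

/-- The Heaviside function. -/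
def heaviside (x : ℝ) : ℂ := if 0 < x then 1 else 0

/-- The distribution `f₋ H(ξ - x) + f₊ H(x - ξ) + ∑_{j < n} c_j δ_ξ^{(j)}`. -/
def jumpDistr (ξ : ℝ) (fm fp : ℝ → ℂ) {n : ℕ} (c : Fin n → ℂ) : Distr :=
  regular (fun x ↦ fm x * heaviside (ξ - x) + fp x * heaviside (x - ξ)) +
    ∑ j : Fin n, c j • D^[(j : ℕ)] (dirac ξ)

/-- `φ ∈ 𝒜` is a solution of
`∑_{i=0}^{2} (2 choose i) (a₀^{(i)} * φ^{(4-i)} + φ^{(4-i)} * a₁^{(i)})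
  - w² (b₀ * φ + φ * b₁) = 0`. -/
def IsSolution (a b : Fin 2 → Distr) (w : ℂ) (φ : Distr) : Prop :=
  InA φ ∧
    ∑ i ∈ Finset.range 3, (Nat.choose 2 i : ℂ) •
        (starProd (D^[i] (a 0)) (D^[4 - i] φ) + starProd (D^[4 - i] φ) (D^[i] (a 1)))
      - w ^ 2 • (starProd (b 0) φ + starProd φ (b 1)) = 0

end BeamDist
end

/-!
A distribution in `𝒜` is a piecewise smooth function `f` plus a finite combination
`∑ c_{s,j} δ_s^{(j)}` of point distributions (`IsRep`). Such decompositions are unique: tested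
against `ρ ^ k T((x - s) / ρ)`, where `T(y) = y ^ k / k!` near `0`, a function contributes nothing
as `ρ → 0`, and `δ_s^{(j)}` contributes only for `j = k`. The same test shows that a distribution of
order at most `k` contains no `δ_s^{(j)}` with `j ≥ k` (`IsRep.coeff_eq_zero`).

Differentiation shifts the coefficients `c_{s,j}` and turns the jumps of `f` into coefficients of
`δ_s` (`IsRep.D`). The product `F * G` can be written down explicitly: for small `ε > 0` the singular
points of `F` and `G(x + ε)` are disjoint, near a singular point of `F` the factor `G(x + ε)` is
smooth, with derivatives close to the right limits of those of `G`, and near a singular point of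
`G(x + ε)` the factor `F` is smooth, with derivatives close to left limits. Hence, with coefficients
`c`, `d` and functions `f`, `g` belonging to `F`, `G`, the coefficient of the highest `δ_s^{(m)}` in
`F * G` is `c_m g(s+) + f(s-) d_m` (`exists_isRep_starProd`).

Let `δ_s^{(m)}` be the highest point distribution at `s` in the fourth derivative of `φ`. If the
point parts of the `a_i` have order at most `p`, those of the `b_i` order at most `p + 2`, and
`m ≥ p + 2`, then in the equation `δ_s^{(m)}` comes only from the term with the fourth derivative,
with the nonzero factor `a₀(s-) + a₁(s+)`. So there is no `δ_s^{(m)}` with `m ≥ p + 2`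
(`iterCoeff_four_eq_zero`). As the `δ_s^{(3)}` and `δ_s^{(2)}` in the fourth derivative measure the
jumps of `φ` and of its first derivative, this gives continuity for `p = 1`, and continuous
differentiability for `p = 0`.
-/

open scoped Distributions ContDiff Topology

noncomputable section

namespace BeamDist

open MeasureTheory Filter Set

/-! ### Evaluation of the basic operations on test functions -/

theorem regular_apply {f : ℝ → ℂ} (hf : LocallyIntegrable f) (t : Test) :
    regular f t = ∫ x, t x * f x := by
  have h : LocallyIntegrableOn f ((⊤ : TopologicalSpace.Opens ℝ) : Set ℝ) :=
    hf.locallyIntegrableOn _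
  exact TestFunction.integralAgainstBilinCLM_eq_integral
    (B := ContinuousLinearMap.mul ℂ ℂ) h (f := t)

theorem D_apply (T : Distr) (t : Test) :
    D T t = -T (TestFunction.lineDerivCLM ℂ (1 : ℝ) t) := rfl

theorem D_iterate_apply (n : ℕ) (T : Distr) (t : Test) :
    D^[n] T t = (-1) ^ n * T ((TestFunction.lineDerivCLM ℂ (1 : ℝ))^[n] t) := by
  induction n generalizing t with
  | zero => simp
  | succ n ih =>
    rw [Function.iterate_succ_apply', D_apply, ih, Function.iterate_succ_apply]
    ring

theorem coe_lineDeriv (t : Test) :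
    ((TestFunction.lineDerivCLM ℂ (1 : ℝ) t : Test) : ℝ → ℂ) = deriv t := by
  funext x
  rw [TestFunction.lineDerivCLM_eq_fderivCLM, TestFunction.fderivCLM_apply_of_le _ (by simp)]
  rfl

theorem coe_lineDeriv_iterate (n : ℕ) (t : Test) :
    (((TestFunction.lineDerivCLM ℂ (1 : ℝ))^[n] t : Test) : ℝ → ℂ) = iteratedDeriv n t := by
  induction n with
  | zero => simp
  | succ n ih => rw [Function.iterate_succ_apply', coe_lineDeriv, ih, iteratedDeriv_succ]

theorem D_iterate_dirac_apply (n : ℕ) (s : ℝ) (t : Test) :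
    D^[n] (dirac s) t = (-1) ^ n * iteratedDeriv n t s := by
  rw [D_iterate_apply, ← coe_lineDeriv_iterate]; rfl

theorem D_iterate_regular_apply (n : ℕ) {f : ℝ → ℂ} (hf : LocallyIntegrable f) (t : Test) :
    D^[n] (regular f) t = (-1) ^ n * ∫ x, iteratedDeriv n t x * f x := by
  rw [D_iterate_apply, regular_apply hf, coe_lineDeriv_iterate]

theorem mulTest_apply (g : ℝ → ℂ) (hg : ContDiff ℝ ∞ g) (t : Test) (x : ℝ) :
    mulTest g hg t x = t x * g x := rfl

theorem shiftTest_apply (ε : ℝ) (t : Test) (x : ℝ) : shiftTest ε t x = t (x - ε) := rfl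

theorem smoothMul_apply (g : ℝ → ℂ) (hg : ContDiff ℝ ∞ g) (T : Distr) (t : Test) :
    smoothMul g hg T t = T (mulTest g hg t) := rfl

theorem shift_apply (ε : ℝ) (T : Distr) (t : Test) : shift ε T t = T (shiftTest ε t) := rfl

/-- The test function given by a smooth function with compact support. -/
def mkTest (f : ℝ → ℂ) (hf : ContDiff ℝ ∞ f) (hc : HasCompactSupport f) : Test :=
  ⟨f, hf, hc, fun _ _ ↦ trivial⟩

theorem coe_mkTest (f : ℝ → ℂ) (hf : ContDiff ℝ ∞ f) (hc : HasCompactSupport f) :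
    (mkTest f hf hc : ℝ → ℂ) = f := rfl

theorem test_contDiff (t : Test) : ContDiff ℝ ∞ t := t.contDiff

theorem iteratedDeriv_eq_zero_of_notMem_tsupport {t : ℝ → ℂ} {x : ℝ} (hx : x ∉ tsupport t) (n : ℕ) :
    iteratedDeriv n t x = 0 := by
  have h : t =ᶠ[𝓝 x] 0 := notMem_tsupport_iff_eventuallyEq.1 hx
  rw [h.iteratedDeriv_eq]; simp

/-! ### Locality of distributions and uniqueness of the Hörmander product -/

/-- Distributions that agree near every point are equal: split a test function by a smooth
partition of unity on its support. -/
theorem eq_of_locally_eq {P Q : Distr}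
    (h : ∀ x : ℝ, ∃ U : Set ℝ, IsOpen U ∧ x ∈ U ∧ EqOnOpen U P Q) : P = Q := by
  ext t
  choose U hUo hxU hU using h
  have hK : IsCompact (tsupport t) := t.hasCompactSupport
  obtain ⟨b, hb⟩ := hK.elim_finite_subcover U hUo (fun x _ ↦ mem_iUnion.2 ⟨x, hxU x⟩)
  obtain ⟨ρ, hρ⟩ := SmoothPartitionOfUnity.exists_isSubordinate (ι := b)
    (modelWithCornersSelf ℝ ℝ) (isClosed_tsupport t) (fun i ↦ U i) (fun i ↦ hUo i)
    (hb.trans (by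
      intro x hx
      obtain ⟨i, hi, hxi⟩ := mem_iUnion₂.1 hx
      exact mem_iUnion.2 ⟨⟨i, hi⟩, hxi⟩))
  have hsm : ∀ i : b, ContDiff ℝ ∞ (fun x ↦ ((ρ i x : ℝ) : ℂ)) := fun i ↦
    Complex.ofRealCLM.contDiff.comp (ρ i).contMDiff.contDiff
  have ht : t = ∑ i : b, mulTest _ (hsm i) t := by
    ext x
    have hsum : (∑ i : b, mulTest _ (hsm i) t) x = ∑ i : b, t x * ((ρ i x : ℝ) : ℂ) := by
      have := map_sum (dirac x) (fun i : b ↦ mulTest _ (hsm i) t) Finset.univ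
      exact this
    rw [hsum, ← Finset.mul_sum]
    by_cases hx : x ∈ tsupport t
    · have h1 := ρ.sum_eq_one hx
      rw [finsum_eq_sum_of_fintype] at h1
      rw [← Complex.ofReal_sum, h1]; simp
    · rw [image_eq_zero_of_notMem_tsupport hx, zero_mul]
  rw [ht, map_sum, map_sum]
  refine Finset.sum_congr rfl fun i _ ↦ hU i _ ?_
  refine subset_trans ?_ (hρ i)
  refine (closure_mono fun x hx ↦ ?_)
  simp only [Function.mem_support, mulTest_apply] at hx ⊢
  intro h0
  exact hx (by rw [h0]; simp)

theorem EqOnOpen.mono {U V : Set ℝ} {F G : Distr} (h : EqOnOpen U F G) (hV : V ⊆ U) :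
    EqOnOpen V F G := fun t ht ↦ h t (ht.trans hV)

theorem EqOnOpen.symm {U : Set ℝ} {F G : Distr} (h : EqOnOpen U F G) : EqOnOpen U G F :=
  fun t ht ↦ (h t ht).symm

theorem EqOnOpen.trans {U : Set ℝ} {F G H : Distr} (h : EqOnOpen U F G) (h' : EqOnOpen U G H) :
    EqOnOpen U F H := fun t ht ↦ (h t ht).trans (h' t ht)

theorem tsupport_mulTest_subset (g : ℝ → ℂ) (hg : ContDiff ℝ ∞ g) (t : Test) :
    tsupport (mulTest g hg t) ⊆ tsupport t :=
  closure_mono fun x hx ↦ by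
    simp only [Function.mem_support, mulTest_apply] at hx ⊢
    exact left_ne_zero_of_mul hx

theorem EqOnOpen.smoothMul {U : Set ℝ} {F G : Distr} (h : EqOnOpen U F G) (g : ℝ → ℂ)
    (hg : ContDiff ℝ ∞ g) : EqOnOpen U (smoothMul g hg F) (smoothMul g hg G) :=
  fun t ht ↦ h _ ((tsupport_mulTest_subset g hg t).trans ht)

theorem smoothMul_regular_comm (g g' : ℝ → ℂ) (hg : ContDiff ℝ ∞ g) (hg' : ContDiff ℝ ∞ g') :
    smoothMul g hg (regular g') = smoothMul g' hg' (regular g) := by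
  ext t
  rw [smoothMul_apply, smoothMul_apply, regular_apply hg'.continuous.locallyIntegrable,
    regular_apply hg.continuous.locallyIntegrable]
  congr 1; ext x; simp only [mulTest_apply]; ring

theorem eqOn_of_regular_eqOnOpen {U : Set ℝ} (hU : IsOpen U) {g g' : ℝ → ℂ} (hg : Continuous g)
    (hg' : Continuous g') (h : EqOnOpen U (regular g) (regular g')) : EqOn g g' U := by
  have hint : LocallyIntegrable (fun x ↦ g x - g' x) := (hg.sub hg').locallyIntegrable
  have h0 := hU.ae_eq_zero_of_integral_contDiff_smul_eq_zero (hint.locallyIntegrableOn U)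
    (fun u hu hc hs ↦ by
      obtain ⟨t, ht⟩ : ∃ t : Test, ∀ x, t x = (u x : ℂ) :=
        ⟨mkTest (fun x ↦ ((u x : ℝ) : ℂ)) (Complex.ofRealCLM.contDiff.comp hu)
          (hc.comp_left (g := fun r : ℝ ↦ (r : ℂ)) (by simp)), fun _ ↦ rfl⟩
      have hts : tsupport t ⊆ U := by
        refine subset_trans (closure_mono fun x hx ↦ ?_) hs
        simp only [Function.mem_support] at hx ⊢
        intro h0; exact hx (by simp [ht, h0])
      have := h t hts
      rw [regular_apply hg.locallyIntegrable, regular_apply hg'.locallyIntegrable] at this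
      have i1 : Integrable (fun x ↦ t x * g x) :=
        (t.continuous.mul hg).integrable_of_hasCompactSupport t.hasCompactSupport.mul_right
      have i2 : Integrable (fun x ↦ t x * g' x) :=
        (t.continuous.mul hg').integrable_of_hasCompactSupport t.hasCompactSupport.mul_right
      rw [← sub_eq_zero, ← integral_sub i1 i2] at this
      rw [← this]
      congr 1; ext x; simp [ht, mul_sub])
  refine Measure.eqOn_open_of_ae_eq (μ := volume) ?_ hU hg.continuousOn hg'.continuousOn
  rw [EventuallyEq, ae_restrict_iff' hU.measurableSet]
  filter_upwards [h0] with x hx hxU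
  exact sub_eq_zero.1 (hx hxU)

theorem smoothMul_eqOnOpen {U : Set ℝ} {g g' : ℝ → ℂ} (hg : ContDiff ℝ ∞ g)
    (hg' : ContDiff ℝ ∞ g') (h : EqOn g g' U) (G : Distr) :
    EqOnOpen U (smoothMul g hg G) (smoothMul g' hg' G) := by
  intro t ht
  rw [smoothMul_apply, smoothMul_apply]
  congr 1
  ext x
  rw [mulTest_apply, mulTest_apply]
  by_cases hx : x ∈ tsupport t
  · rw [h (ht hx)]
  · rw [image_eq_zero_of_notMem_tsupport hx, zero_mul, zero_mul]

theorem IsHormanderProd.unique {F G P P' : Distr} (h : IsHormanderProd F G P)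
    (h' : IsHormanderProd F G P') : P = P' := by
  refine eq_of_locally_eq fun x ↦ ?_
  obtain ⟨U, hU, hxU, g, hg, H⟩ := h x
  obtain ⟨U', hU', hxU', g', hg', H'⟩ := h' x
  refine ⟨U ∩ U', hU.inter hU', ⟨hxU, hxU'⟩, ?_⟩
  have key : ∀ {F₁ : Distr}, EqOnOpen U F₁ (regular g) → EqOnOpen U' F₁ (regular g') →
      EqOn g g' (U ∩ U') := fun h1 h2 ↦
    eqOn_of_regular_eqOnOpen (hU.inter hU') hg.continuous hg'.continuous
      ((h1.mono inter_subset_left).symm.trans (h2.mono inter_subset_right))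
  -- If the two local descriptions use different factors, both give the product `g g'`.
  have cross : ∀ {F₁ G₁ : Distr}, EqOnOpen U F₁ (regular g) → EqOnOpen U' G₁ (regular g') →
      EqOnOpen (U ∩ U') (smoothMul g hg G₁) (smoothMul g' hg' F₁) := fun {F₁ G₁} h1 h2 ↦ by
    refine ((h2.mono inter_subset_right).smoothMul g hg).trans ?_
    rw [smoothMul_regular_comm g g' hg hg']
    exact ((h1.mono inter_subset_left).smoothMul g' hg').symm
  rcases H with ⟨H1, H2⟩ | ⟨H1, H2⟩ <;> rcases H' with ⟨H1', H2'⟩ | ⟨H1', H2'⟩ <;>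
    refine (H2.mono inter_subset_left).trans (EqOnOpen.trans ?_ (H2'.mono inter_subset_right).symm)
  · exact smoothMul_eqOnOpen hg hg' (key H1 H1') G
  · exact cross H1 H1'
  · exact cross H1 H1'
  · exact smoothMul_eqOnOpen hg hg' (key H1 H1') F

theorem IsStarProd.starProd_eq {F G P : Distr} (h : IsStarProd F G P) : starProd F G = P := by
  have hex : ∃ P, IsStarProd F G P := ⟨P, h⟩
  rw [starProd, dif_pos hex]
  obtain ⟨Q, hQ, hl⟩ := hex.choose_spec
  obtain ⟨Q', hQ', hl'⟩ := h
  ext t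
  refine tendsto_nhds_unique (hl t) ((hl' t).congr' ?_)
  filter_upwards [hQ, hQ'] with ε h1 h2
  rw [h1.unique h2]

/-! ### Probing the coefficients of point-supported distributions -/

theorem iteratedDeriv_ofReal_comp {f : ℝ → ℝ} (hf : ContDiff ℝ ∞ f) (n : ℕ) :
    iteratedDeriv n (fun x ↦ ((f x : ℝ) : ℂ)) = fun x ↦ ((iteratedDeriv n f x : ℝ) : ℂ) := by
  induction n with
  | zero => simp
  | succ n ih =>
    rw [iteratedDeriv_succ, ih, iteratedDeriv_succ]
    funext x
    have hd : Differentiable ℝ (iteratedDeriv n f) :=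
      hf.differentiable_iteratedDeriv n (by exact_mod_cast WithTop.coe_lt_top _)
    exact ((hd x).hasDerivAt.ofReal_comp).deriv

/-- The function `y ^ k / k!`, cut off smoothly outside `[-1, 1]`. -/
def bumpMonomial (k : ℕ) (y : ℝ) : ℂ :=
  (((y ^ k / k.factorial) * (⟨1, 2, one_pos, one_lt_two⟩ : ContDiffBump (0 : ℝ)) y : ℝ) : ℂ)

theorem contDiff_bumpMonomial (k : ℕ) : ContDiff ℝ ∞ (bumpMonomial k) :=
  Complex.ofRealCLM.contDiff.comp
    (((contDiff_id.pow k).div_const _).mul (ContDiffBump.contDiff _))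

theorem bumpMonomial_eq_zero (k : ℕ) {y : ℝ} (hy : 2 ≤ |y|) : bumpMonomial k y = 0 := by
  rw [bumpMonomial, ContDiffBump.zero_of_le_dist _ (by simpa using hy)]
  simp

theorem tsupport_bumpMonomial (k : ℕ) : tsupport (bumpMonomial k) ⊆ Metric.closedBall 0 2 := by
  refine closure_minimal (fun y hy ↦ ?_) Metric.isClosed_closedBall
  by_contra h
  refine hy (bumpMonomial_eq_zero k ?_)
  simp at h
  exact h.le

theorem hasCompactSupport_bumpMonomial (k : ℕ) : HasCompactSupport (bumpMonomial k) :=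
  (isCompact_closedBall (0 : ℝ) 2).of_isClosed_subset (isClosed_tsupport _)
    (tsupport_bumpMonomial k)

theorem iteratedDeriv_bumpMonomial_zero (k j : ℕ) :
    iteratedDeriv j (bumpMonomial k) 0 = if j = k then 1 else 0 := by
  have h : bumpMonomial k =ᶠ[𝓝 0] fun y ↦ ((y ^ k / k.factorial : ℝ) : ℂ) := by
    filter_upwards [Metric.closedBall_mem_nhds (0 : ℝ) one_pos] with y hy
    rw [bumpMonomial, ContDiffBump.one_of_mem_closedBall _ hy, mul_one]
  rw [h.iteratedDeriv_eq, iteratedDeriv_ofReal_comp (by fun_prop)]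
  simp_rw [div_eq_mul_inv]
  rw [iteratedDeriv_mul_const_field, iteratedDeriv_fun_pow_zero]
  split_ifs with h
  · have : (k.factorial : ℝ) ≠ 0 := by positivity
    simp [this]
  · simp

theorem contDiff_probe (s : ℝ) (k : ℕ) (ρ : ℝ) :
    ContDiff ℝ ∞ fun x ↦ (ρ ^ k : ℝ) • bumpMonomial k (ρ⁻¹ * (x - s)) := by
  have := contDiff_bumpMonomial k
  fun_prop

theorem hasCompactSupport_probe (s : ℝ) (k : ℕ) {ρ : ℝ} (hρ : 0 < ρ) :
    HasCompactSupport fun x ↦ (ρ ^ k : ℝ) • bumpMonomial k (ρ⁻¹ * (x - s)) := by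
  refine HasCompactSupport.of_support_subset_isCompact (isCompact_closedBall s (2 * ρ)) ?_
  intro x hx
  by_contra h
  rw [Metric.mem_closedBall, Real.dist_eq, not_le] at h
  refine hx ?_
  have h2 : 2 ≤ |ρ⁻¹ * (x - s)| := by
    rw [abs_mul, abs_of_pos (inv_pos.2 hρ), ← div_eq_inv_mul, le_div_iff₀ hρ]
    exact h.le
  simp only [bumpMonomial_eq_zero k h2, smul_zero]

/-- The test function `ρ ^ k • bumpMonomial k ((x - s) / ρ)`, supported in `[s - 2ρ, s + 2ρ]`, for
`ρ > 0` (and `0` otherwise). As `ρ → 0` it singles out the coefficient of `δ_s^{(k)}`. -/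
def probe (s : ℝ) (k : ℕ) (ρ : ℝ) : Test :=
  if h : 0 < ρ then mkTest _ (contDiff_probe s k ρ) (hasCompactSupport_probe s k h) else 0

theorem iteratedDeriv_probe (s : ℝ) (k : ℕ) {ρ : ℝ} (hρ : 0 < ρ) (n : ℕ) (x : ℝ) :
    iteratedDeriv n (probe s k ρ) x =
      (ρ ^ k * ρ⁻¹ ^ n : ℝ) • iteratedDeriv n (bumpMonomial k) (ρ⁻¹ * (x - s)) := by
  rw [probe, dif_pos hρ, coe_mkTest]
  have h1 : ContDiff ℝ ∞ fun x ↦ bumpMonomial k (ρ⁻¹ * x) := by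
    have := contDiff_bumpMonomial k
    fun_prop
  rw [iteratedDeriv_fun_const_smul_field]
  have := congrFun (iteratedDeriv_comp_sub_const n (fun x ↦ bumpMonomial k (ρ⁻¹ * x)) s) x
  rw [this, iteratedDeriv_comp_const_smul ((contDiff_bumpMonomial k).of_le (by exact_mod_cast le_top)),
    mul_smul]

theorem iteratedDeriv_bumpMonomial_eq_zero (k n : ℕ) {y : ℝ} (hy : 2 < |y|) :
    iteratedDeriv n (bumpMonomial k) y = 0 :=
  iteratedDeriv_eq_zero_of_notMem_tsupport
    (fun h ↦ by simpa using (tsupport_bumpMonomial k h).trans_lt hy) n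

theorem eventually_two_lt {x s : ℝ} (h : x ≠ s) : ∀ᶠ ρ in 𝓝[>] (0 : ℝ), 2 < |ρ⁻¹ * (x - s)| := by
  have h0 : 0 < |x - s| := abs_pos.2 (sub_ne_zero.2 h)
  filter_upwards [Ioo_mem_nhdsGT (show (0 : ℝ) < |x - s| / 2 by positivity)] with ρ hρ
  rw [abs_mul, abs_of_pos (inv_pos.2 hρ.1), ← div_eq_inv_mul, lt_div_iff₀ hρ.1]
  linarith [hρ.2]

/-- The `n`-th derivative of the probe is `O(ρ ^ (k - n))` on an interval that shrinks to a point, so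
its integral against a locally integrable function tends to `0` even for `n = k`. -/
theorem tendsto_D_iterate_regular_probe {g : ℝ → ℂ} (hg : LocallyIntegrable g) (s : ℝ) {n k : ℕ}
    (hnk : n ≤ k) :
    Tendsto (fun ρ ↦ D^[n] (regular g) (probe s k ρ)) (𝓝[>] 0) (𝓝 0) := by
  simp_rw [D_iterate_regular_apply n hg]
  rw [← mul_zero ((-1 : ℂ) ^ n)]
  refine Tendsto.const_mul _ ?_
  have hcont : Continuous (iteratedDeriv n (bumpMonomial k)) :=
    (contDiff_bumpMonomial k).continuous_iteratedDeriv n (by exact_mod_cast le_top)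
  have hcs : HasCompactSupport (iteratedDeriv n (bumpMonomial k)) :=
    HasCompactSupport.of_support_subset_isCompact (hasCompactSupport_bumpMonomial k)
      (fun x hx ↦ by
        by_contra h
        exact hx (iteratedDeriv_eq_zero_of_notMem_tsupport h n))
  obtain ⟨C, hC⟩ := hcs.exists_bound_of_continuous hcont
  have hC0 : 0 ≤ C := (norm_nonneg _).trans (hC 0)
  rw [← integral_zero ℝ ℂ]
  refine tendsto_integral_filter_of_dominated_convergence
    ((Metric.closedBall s 2).indicator fun x ↦ C * ‖g x‖) ?_ ?_ ?_ ?_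
  · refine Eventually.of_forall fun ρ ↦ ?_
    exact ((test_contDiff (probe s k ρ)).continuous_iteratedDeriv n
      (by exact_mod_cast le_top)).aestronglyMeasurable.mul hg.aestronglyMeasurable
  · filter_upwards [Ioo_mem_nhdsGT (zero_lt_one' ℝ)] with ρ hρ
    refine Eventually.of_forall fun x ↦ ?_
    rw [iteratedDeriv_probe s k hρ.1]
    by_cases hx : x ∈ Metric.closedBall s 2
    · rw [indicator_of_mem hx, norm_mul, norm_smul]
      have h1 : ‖ρ ^ k * ρ⁻¹ ^ n‖ ≤ 1 := by
        rw [Real.norm_of_nonneg (by have := hρ.1; positivity)]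
        obtain ⟨d, rfl⟩ := Nat.exists_eq_add_of_le hnk
        have : ρ ^ (n + d) * ρ⁻¹ ^ n = ρ ^ d := by
          rw [pow_add, mul_right_comm, ← mul_pow, mul_inv_cancel₀ hρ.1.ne', one_pow, one_mul]
        rw [this]
        exact pow_le_one₀ hρ.1.le hρ.2.le
      gcongr
      calc _ ≤ 1 * C := mul_le_mul h1 (hC _) (norm_nonneg _) zero_le_one
        _ = C := one_mul C
    · rw [indicator_of_notMem hx, iteratedDeriv_bumpMonomial_eq_zero]
      · simp
      · rw [abs_mul, abs_of_pos (inv_pos.2 hρ.1)]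
        rw [Metric.mem_closedBall, Real.dist_eq, not_le] at hx
        have : 1 ≤ ρ⁻¹ := (one_le_inv₀ hρ.1).2 hρ.2.le
        nlinarith
  · rw [integrable_indicator_iff Metric.isClosed_closedBall.measurableSet]
    exact ((hg.integrableOn_isCompact (isCompact_closedBall s 2)).norm.const_mul C)
  · have hne : ∀ᵐ x : ℝ, x ≠ s := by
      simp [ae_iff, measure_singleton]
    filter_upwards [hne] with x hx
    refine tendsto_const_nhds.congr' ?_
    filter_upwards [eventually_two_lt hx, self_mem_nhdsWithin] with ρ hρ hρ0
    rw [iteratedDeriv_probe s k hρ0, iteratedDeriv_bumpMonomial_eq_zero k n hρ]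
    simp

theorem tendsto_D_iterate_dirac_probe (s s' : ℝ) (j k : ℕ) :
    Tendsto (fun ρ ↦ D^[j] (dirac s') (probe s k ρ)) (𝓝[>] 0)
      (𝓝 (if s' = s ∧ j = k then (-1) ^ k else 0)) := by
  refine tendsto_const_nhds.congr' ?_
  by_cases hs : s' = s
  · subst hs
    filter_upwards [self_mem_nhdsWithin] with ρ hρ
    rw [D_iterate_dirac_apply, iteratedDeriv_probe _ _ hρ, sub_self, mul_zero,
      iteratedDeriv_bumpMonomial_zero]
    by_cases hj : j = k
    · subst hj
      have : ρ ^ j * ρ⁻¹ ^ j = 1 := by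
        rw [← mul_pow, mul_inv_cancel₀ (ne_of_gt hρ), one_pow]
      rw [this]
      simp
    · simp [hj]
  · filter_upwards [eventually_two_lt hs, self_mem_nhdsWithin] with ρ hρ hρ0
    rw [D_iterate_dirac_apply, iteratedDeriv_probe _ _ hρ0,
      iteratedDeriv_bumpMonomial_eq_zero k j hρ]
    simp [hs]

/-- The distribution `f + ∑_{s ∈ S} ∑_{j < N} c_{s,j} δ_s^{(j)}`. -/
def rep (S : Finset ℝ) (N : ℕ) (f : ℝ → ℂ) (c : ℝ → ℕ → ℂ) : Distr :=
  regular f + ∑ s ∈ S, ∑ j ∈ Finset.range N, c s j • D^[j] (dirac s)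

/-- `F` is the sum of the locally integrable function `f` and the point distributions
`∑_{s ∈ S} ∑_j c_{s,j} δ_s^{(j)}`, with finitely many nonzero coefficients. -/
structure IsRep (S : Finset ℝ) (F : Distr) (f : ℝ → ℂ) (c : ℝ → ℕ → ℂ) : Prop where
  locallyIntegrable : LocallyIntegrable f
  exists_eq : ∃ N, (∀ s j, N ≤ j → c s j = 0) ∧ F = rep S N f c

theorem rep_apply {S : Finset ℝ} {N : ℕ} {f : ℝ → ℂ} (hf : LocallyIntegrable f)
    (c : ℝ → ℕ → ℂ) (t : Test) :
    rep S N f c t = (∫ x, t x * f x) +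
      ∑ s ∈ S, ∑ j ∈ Finset.range N, c s j * ((-1) ^ j * iteratedDeriv j t s) := by
  simp only [rep, add_apply, sum_apply, smul_apply, smul_eq_mul, D_iterate_dirac_apply,
    regular_apply hf]

theorem integrable_test_mul {f : ℝ → ℂ} (hf : LocallyIntegrable f) (t : Test) :
    Integrable fun x ↦ t x * f x :=
  hf.integrable_smul_left_of_hasCompactSupport t.continuous t.hasCompactSupport

theorem rep_mono {S : Finset ℝ} {N M : ℕ} {f : ℝ → ℂ} {c : ℝ → ℕ → ℂ}
    (hc : ∀ s j, N ≤ j → c s j = 0) (h : N ≤ M) : rep S N f c = rep S M f c := by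
  ext t
  simp only [rep, add_apply, sum_apply, smul_apply, smul_eq_mul]
  congr 1
  refine Finset.sum_congr rfl fun s _ ↦ ?_
  refine Finset.sum_subset (Finset.range_mono h) fun j _ hj ↦ ?_
  rw [hc s j (by simpa using hj), zero_mul]

theorem IsRep.exists_forall {S : Finset ℝ} {F : Distr} {f : ℝ → ℂ} {c : ℝ → ℕ → ℂ}
    (h : IsRep S F f c) : ∃ N, ∀ M, N ≤ M → (∀ s j, M ≤ j → c s j = 0) ∧ F = rep S M f c := by
  obtain ⟨N, hN, hF⟩ := h.exists_eq
  exact ⟨N, fun M hM ↦ ⟨fun s j hj ↦ hN s j (hM.trans hj), hF.trans (rep_mono hN hM)⟩⟩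

theorem rep_add {S : Finset ℝ} {N : ℕ} {f g : ℝ → ℂ} (hf : LocallyIntegrable f)
    (hg : LocallyIntegrable g) (c d : ℝ → ℕ → ℂ) :
    rep S N f c + rep S N g d = rep S N (f + g) (c + d) := by
  ext t
  rw [add_apply, rep_apply hf, rep_apply hg, rep_apply (hf.add hg)]
  simp only [Pi.add_apply, add_mul, mul_add, Finset.sum_add_distrib]
  rw [integral_add (integrable_test_mul hf t) (integrable_test_mul hg t)]
  ring

theorem rep_smul {S : Finset ℝ} {N : ℕ} {f : ℝ → ℂ} (hf : LocallyIntegrable f) (z : ℂ)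
    (c : ℝ → ℕ → ℂ) : z • rep S N f c = rep S N (z • f) (z • c) := by
  ext t
  rw [smul_apply, rep_apply hf, rep_apply (hf.smul z)]
  simp only [Pi.smul_apply, smul_eq_mul, mul_add, Finset.mul_sum, ← mul_assoc]
  congr 1
  rw [← integral_const_mul]
  congr 1; ext x; ring

theorem IsRep.add {S : Finset ℝ} {F G : Distr} {f g : ℝ → ℂ} {c d : ℝ → ℕ → ℂ}
    (hF : IsRep S F f c) (hG : IsRep S G g d) : IsRep S (F + G) (f + g) (c + d) := by
  obtain ⟨N, hN⟩ := hF.exists_forall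
  obtain ⟨M, hM⟩ := hG.exists_forall
  obtain ⟨h1, h2⟩ := hN (max N M) (le_max_left _ _)
  obtain ⟨h3, h4⟩ := hM (max N M) (le_max_right _ _)
  refine ⟨hF.1.add hG.1, max N M, fun s j hj ↦ by simp [h1 s j hj, h3 s j hj], ?_⟩
  rw [h2, h4, rep_add hF.1 hG.1]

theorem IsRep.smul {S : Finset ℝ} {F : Distr} {f : ℝ → ℂ} {c : ℝ → ℕ → ℂ}
    (hF : IsRep S F f c) (z : ℂ) : IsRep S (z • F) (z • f) (z • c) := by
  obtain ⟨N, h1, h2⟩ := hF.exists_eq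
  exact ⟨hF.1.smul z, N, fun s j hj ↦ by simp [h1 s j hj], by rw [h2, rep_smul hF.1]⟩

/-- A distribution of order at most `k` has no `δ_s^{(k)}` in its decomposition. -/
theorem IsRep.coeff_eq_zero {S : Finset ℝ} {F : Distr} {f : ℝ → ℂ} {c : ℝ → ℕ → ℂ}
    (hF : IsRep S F f c) {n k : ℕ} (hnk : n ≤ k) {g : ℝ → ℂ} (hg : LocallyIntegrable g)
    (h : F = D^[n] (regular g)) {s : ℝ} (hs : s ∈ S) : c s k = 0 := by
  obtain ⟨N, hN⟩ := hF.exists_forall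
  obtain ⟨-, hr⟩ := hN (max N (k + 1)) (le_max_left _ _)
  set M := max N (k + 1)
  have hkM : k ∈ Finset.range M := Finset.mem_range.2 (le_max_right N (k + 1))
  have l1 := tendsto_D_iterate_regular_probe hg s hnk
  rw [← h, hr] at l1
  have l2 : Tendsto (fun ρ ↦ rep S M f c (probe s k ρ)) (𝓝[>] 0)
      (𝓝 (0 + ∑ s' ∈ S, ∑ j ∈ Finset.range M,
        c s' j * (if s' = s ∧ j = k then (-1) ^ k else 0))) := by
    simp only [rep, add_apply, sum_apply,
      smul_apply, smul_eq_mul]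
    refine Tendsto.add ?_ (tendsto_finsetSum _ fun s' _ ↦ tendsto_finsetSum _ fun j _ ↦
      (tendsto_D_iterate_dirac_probe s s' j k).const_mul _)
    exact tendsto_D_iterate_regular_probe hF.1 s (Nat.zero_le k)
  have e := tendsto_nhds_unique l1 l2
  rw [zero_add, Finset.sum_eq_single_of_mem s hs (fun b _ hb ↦ by simp [hb]),
    Finset.sum_eq_single_of_mem k hkM (fun b _ hb ↦ by simp [hb])] at e
  simpa using e.symm

theorem IsRep.coeff_eq_zero_of_eq_zero {S : Finset ℝ} {f : ℝ → ℂ} {c : ℝ → ℕ → ℂ}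
    (hF : IsRep S 0 f c) {s : ℝ} (hs : s ∈ S) (k : ℕ) : c s k = 0 := by
  have h0 : LocallyIntegrable (fun _ : ℝ ↦ (0 : ℂ)) := continuous_const.locallyIntegrable
  refine hF.coeff_eq_zero (Nat.zero_le k) h0 ?_ hs
  ext t
  simp [regular_apply h0]

/-- The order, when at most `k`, is attained. -/
theorem exists_of_ord_le {F : Distr} {k : ℕ} (h : ord F ≤ k) :
    ∃ n ≤ k, ∃ g : ℝ → ℂ, LocallyIntegrable g ∧ F = D^[n] (regular g) := by
  by_contra! hcon
  have : ((k + 1 : ℕ) : ℕ∞) ≤ ord F := by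
    refine le_iInf₂ fun n hn ↦ ?_
    obtain ⟨g, hg, hF⟩ := hn
    have : k < n := by
      by_contra! hle
      exact hcon n hle g hg hF
    exact_mod_cast this
  have := this.trans h
  norm_cast at this
  omega

theorem IsRep.coeff_eq_zero_of_ord_le {S : Finset ℝ} {F : Distr} {f : ℝ → ℂ} {c : ℝ → ℕ → ℂ}
    (hF : IsRep S F f c) {k : ℕ} (h : ord F ≤ k) {s : ℝ} (hs : s ∈ S) {j : ℕ} (hj : k ≤ j) :
    c s j = 0 := by
  obtain ⟨n, hn, g, hg, he⟩ := exists_of_ord_le h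
  exact hF.coeff_eq_zero (hn.trans hj) hg he hs

/-! ### Piecewise smooth functions: one-sided limits and local bounds -/

/-- `f` is piecewise smooth with all its singular points in the finite set `S`. -/
structure PSOn (S : Finset ℝ) (f : ℝ → ℂ) : Prop where
  contDiffOn : ContDiffOn ℝ ∞ f (S : Set ℝ)ᶜ
  left : ∀ x ∈ S, ∀ n : ℕ, ∃ l : ℂ, Tendsto (iteratedDeriv n f) (𝓝[<] x) (𝓝 l)
  right : ∀ x ∈ S, ∀ n : ℕ, ∃ r : ℂ, Tendsto (iteratedDeriv n f) (𝓝[>] x) (𝓝 r)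

/-- The right limit `f(x+)`; meaningful only where it exists, as it does everywhere for piecewise
smooth `f` (`PSOn.tendsto_rlim`). -/
def rlim (f : ℝ → ℂ) (x : ℝ) : ℂ := limUnder (𝓝[>] x) f

/-- The left limit `f(x-)`, with the same proviso. -/
def llim (f : ℝ → ℂ) (x : ℝ) : ℂ := limUnder (𝓝[<] x) f

theorem rlim_eq {f : ℝ → ℂ} {x : ℝ} {l : ℂ} (h : Tendsto f (𝓝[>] x) (𝓝 l)) : rlim f x = l :=
  h.limUnder_eq

theorem llim_eq {f : ℝ → ℂ} {x : ℝ} {l : ℂ} (h : Tendsto f (𝓝[<] x) (𝓝 l)) : llim f x = l :=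
  h.limUnder_eq

theorem PiecewiseSmooth.exists_psOn {f : ℝ → ℂ} (h : PiecewiseSmooth f) : ∃ S, PSOn S f := by
  obtain ⟨S, h1, h2⟩ := h
  exact ⟨S, h1, fun x hx n ↦ (h2 x hx n).1, fun x hx n ↦ (h2 x hx n).2⟩

theorem isOpen_compl_finset (S : Finset ℝ) : IsOpen ((S : Set ℝ)ᶜ) :=
  S.finite_toSet.isClosed.isOpen_compl

theorem PSOn.deriv {S : Finset ℝ} {f : ℝ → ℂ} (h : PSOn S f) : PSOn S (deriv f) where
  contDiffOn := h.contDiffOn.deriv_of_isOpen (isOpen_compl_finset S) (by simp)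
  left x hx n := by simpa only [iteratedDeriv_succ'] using h.left x hx (n + 1)
  right x hx n := by simpa only [iteratedDeriv_succ'] using h.right x hx (n + 1)

theorem PSOn.iteratedDeriv {S : Finset ℝ} {f : ℝ → ℂ} (h : PSOn S f) (n : ℕ) :
    PSOn S (iteratedDeriv n f) := by
  induction n with
  | zero => simpa using h
  | succ n ih => rw [iteratedDeriv_succ]; exact ih.deriv

theorem PSOn.contDiffAt {S : Finset ℝ} {f : ℝ → ℂ} (h : PSOn S f) {x : ℝ} (hx : x ∉ S) :
    ContDiffAt ℝ ∞ f x :=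
  h.contDiffOn.contDiffAt ((isOpen_compl_finset S).mem_nhds (by simpa using hx))

theorem PSOn.continuousAt {S : Finset ℝ} {f : ℝ → ℂ} (h : PSOn S f) {x : ℝ} (hx : x ∉ S) :
    ContinuousAt f x := (h.contDiffAt hx).continuousAt

theorem PSOn.hasDerivAt {S : Finset ℝ} {f : ℝ → ℂ} (h : PSOn S f) {x : ℝ} (hx : x ∉ S) :
    HasDerivAt f (_root_.deriv f x) x :=
  ((h.contDiffAt hx).differentiableAt (by simp)).hasDerivAt

theorem PSOn.mono {S S' : Finset ℝ} {f : ℝ → ℂ} (h : PSOn S f) (hS : S ⊆ S') : PSOn S' f where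
  contDiffOn := h.contDiffOn.mono (compl_subset_compl.2 (by exact_mod_cast hS))
  left x _ n := by
    by_cases hx : x ∈ S
    · exact h.left x hx n
    · exact ⟨_, ((h.iteratedDeriv n).continuousAt hx).tendsto.mono_left nhdsWithin_le_nhds⟩
  right x _ n := by
    by_cases hx : x ∈ S
    · exact h.right x hx n
    · exact ⟨_, ((h.iteratedDeriv n).continuousAt hx).tendsto.mono_left nhdsWithin_le_nhds⟩

theorem PSOn.tendsto_rlim {S : Finset ℝ} {f : ℝ → ℂ} (h : PSOn S f) (x : ℝ) :
    Tendsto f (𝓝[>] x) (𝓝 (rlim f x)) := by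
  obtain ⟨r, hr⟩ := (h.mono (Finset.subset_insert x S)).right x (Finset.mem_insert_self x S) 0
  rw [iteratedDeriv_zero] at hr
  rwa [rlim_eq hr]

theorem PSOn.tendsto_llim {S : Finset ℝ} {f : ℝ → ℂ} (h : PSOn S f) (x : ℝ) :
    Tendsto f (𝓝[<] x) (𝓝 (llim f x)) := by
  obtain ⟨r, hr⟩ := (h.mono (Finset.subset_insert x S)).left x (Finset.mem_insert_self x S) 0
  rw [iteratedDeriv_zero] at hr
  rwa [llim_eq hr]

/-- Measurable and bounded near every point. -/
structure LocBdd (f : ℝ → ℂ) : Prop where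
  measurable : AEStronglyMeasurable f
  bound : ∀ x, ∃ C, ∀ᶠ y in 𝓝 x, ‖f y‖ ≤ C

theorem LocBdd.locallyIntegrable {f : ℝ → ℂ} (h : LocBdd f) : LocallyIntegrable f := fun x ↦ by
  obtain ⟨C, hC⟩ := h.bound x
  exact (volume.finiteAt_nhds x).integrableAtFilter
    ⟨univ, univ_mem, h.measurable.restrict⟩ ⟨C, by simpa using hC⟩

theorem LocBdd.mul {f g : ℝ → ℂ} (hf : LocBdd f) (hg : LocBdd g) : LocBdd (fun x ↦ f x * g x) where
  measurable := hf.measurable.mul hg.measurable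
  bound x := by
    obtain ⟨C, hC⟩ := hf.bound x
    obtain ⟨C', hC'⟩ := hg.bound x
    refine ⟨C * C', ?_⟩
    filter_upwards [hC, hC'] with y h1 h2
    rw [norm_mul]
    exact mul_le_mul h1 h2 (norm_nonneg _) ((norm_nonneg _).trans h1)

theorem LocBdd.exists_bound {f : ℝ → ℂ} (h : LocBdd f) {K : Set ℝ} (hK : IsCompact K) :
    ∃ C, 0 ≤ C ∧ ∀ x ∈ K, ‖f x‖ ≤ C := by
  refine hK.induction_on ⟨0, le_rfl, by simp⟩
    (fun s t hst ⟨C, h0, hC⟩ ↦ ⟨C, h0, fun x hx ↦ hC x (hst hx)⟩) ?_ ?_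
  · rintro s t ⟨C, h0, hC⟩ ⟨C', h0', hC'⟩
    refine ⟨max C C', le_max_of_le_left h0, fun x hx ↦ ?_⟩
    rcases hx with hx | hx
    · exact (hC x hx).trans (le_max_left _ _)
    · exact (hC' x hx).trans (le_max_right _ _)
  · intro x _
    obtain ⟨C, hC⟩ := h.bound x
    exact ⟨{y | ‖f y‖ ≤ C}, mem_nhdsWithin_of_mem_nhds hC, max C 0, le_max_right _ _,
      fun y hy ↦ le_trans hy (le_max_left _ _)⟩

theorem LocBdd.comp_add {f : ℝ → ℂ} (h : LocBdd f) (ε : ℝ) : LocBdd (fun x ↦ f (x + ε)) where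
  measurable := h.measurable.comp_quasiMeasurePreserving
    (measurePreserving_add_right volume ε).quasiMeasurePreserving
  bound x := by
    obtain ⟨C, hC⟩ := h.bound (x + ε)
    exact ⟨C, (continuous_add_const ε).continuousAt.eventually hC⟩

theorem ae_notMem_finset (S : Finset ℝ) : ∀ᵐ x : ℝ, x ∉ S := by
  have : volume (S : Set ℝ) = 0 := S.finite_toSet.measure_zero _
  exact measure_eq_zero_iff_ae_notMem.1 this

theorem PSOn.locBdd {S : Finset ℝ} {f : ℝ → ℂ} (h : PSOn S f) : LocBdd f where
  measurable := by
    have h1 : AEStronglyMeasurable f (volume.restrict (S : Set ℝ)ᶜ) :=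
      h.contDiffOn.continuousOn.aestronglyMeasurable (isOpen_compl_finset S).measurableSet
    have h2 : ∀ᵐ x : ℝ, x ∈ (S : Set ℝ)ᶜ := ae_notMem_finset S
    rwa [Measure.restrict_eq_self_of_ae_mem h2] at h1
  bound x := by
    obtain ⟨C, hC⟩ := (h.tendsto_rlim x).norm.isBoundedUnder_le
    obtain ⟨C', hC'⟩ := (h.tendsto_llim x).norm.isBoundedUnder_le
    rw [eventually_map] at hC hC'
    refine ⟨max (max C C') ‖f x‖, ?_⟩
    have hx : ∀ᶠ y in 𝓝[≠] x, ‖f y‖ ≤ max (max C C') ‖f x‖ := by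
      rw [← nhdsLT_sup_nhdsGT, eventually_sup]
      exact ⟨hC'.mono fun y hy ↦ by simp [hy], hC.mono fun y hy ↦ by simp [hy]⟩
    rw [eventually_nhdsWithin_iff] at hx
    filter_upwards [hx] with y hy
    by_cases hyx : y = x
    · simp [hyx]
    · exact hy hyx

theorem PSOn.locallyIntegrable {S : Finset ℝ} {f : ℝ → ℂ} (h : PSOn S f) : LocallyIntegrable f :=
  h.locBdd.locallyIntegrable

/-- A function without jumps is continuous after a change at finitely many points. -/
theorem exists_continuous_of_no_jump {S : Finset ℝ} {f : ℝ → ℂ}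
    (hc : ∀ x, x ∉ S → ContinuousAt f x)
    (hj : ∀ x ∈ S, ∃ l, Tendsto f (𝓝[<] x) (𝓝 l) ∧ Tendsto f (𝓝[>] x) (𝓝 l)) :
    ∃ g : ℝ → ℂ, Continuous g ∧ ∀ x, x ∉ S → g x = f x := by
  have h : ∀ x, ∃ l, Tendsto f (𝓝[≠] x) (𝓝 l) ∧ (x ∉ S → l = f x) := fun x ↦ by
    by_cases hx : x ∈ S
    · obtain ⟨l, h1, h2⟩ := hj x hx
      refine ⟨l, ?_, fun h ↦ absurd hx h⟩
      rw [← nhdsLT_sup_nhdsGT]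
      exact h1.sup h2
    · exact ⟨f x, (hc x hx).tendsto.mono_left nhdsWithin_le_nhds, fun _ ↦ rfl⟩
  choose g hg hgf using h
  refine ⟨g, ?_, hgf⟩
  rw [continuous_iff_continuousAt]
  intro x
  rw [continuousAt_iff_punctured_nhds]
  refine (hg x).congr' ?_
  have : ∀ᶠ y in 𝓝[≠] x, y ∉ S := by
    have : ((S.erase x : Finset ℝ) : Set ℝ)ᶜ ∈ 𝓝 x :=
      (isOpen_compl_finset _).mem_nhds (by simp)
    filter_upwards [mem_nhdsWithin_of_mem_nhds this, self_mem_nhdsWithin] with y hy hyx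
    simp only [mem_compl_iff, SetLike.mem_coe, Finset.mem_erase, not_and] at hy
    exact hy hyx
  filter_upwards [this] with y hy
  exact (hgf y hy).symm

theorem PSOn.exists_continuous {S : Finset ℝ} {f : ℝ → ℂ} (h : PSOn S f)
    (hj : ∀ x ∈ S, rlim f x = llim f x) :
    ∃ g : ℝ → ℂ, Continuous g ∧ ∀ x, x ∉ S → g x = f x :=
  exists_continuous_of_no_jump (fun _ hx ↦ h.continuousAt hx) fun x hx ↦
    ⟨llim f x, h.tendsto_llim x, hj x hx ▸ h.tendsto_rlim x⟩

theorem regular_congr {S : Finset ℝ} {f g : ℝ → ℂ} (hf : LocallyIntegrable f)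
    (hg : LocallyIntegrable g) (h : ∀ x, x ∉ S → g x = f x) : regular f = regular g := by
  ext t
  rw [regular_apply hf, regular_apply hg]
  refine integral_congr_ae ?_
  filter_upwards [ae_notMem_finset S] with x hx
  rw [h x hx]

/-- Without jumps of `f` and `f'`, the continuous version of `f` is the primitive of the continuous
version of `f'`. -/
theorem PSOn.exists_contDiff_one {S : Finset ℝ} {f : ℝ → ℂ} (h : PSOn S f)
    (hj : ∀ x ∈ S, rlim f x = llim f x)
    (hj' : ∀ x ∈ S, rlim (_root_.deriv f) x = llim (_root_.deriv f) x) :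
    ∃ g : ℝ → ℂ, ContDiff ℝ 1 g ∧ ∀ x, x ∉ S → g x = f x := by
  obtain ⟨g, hg, hgf⟩ := h.exists_continuous hj
  obtain ⟨g', hg', hgf'⟩ := h.deriv.exists_continuous hj'
  refine ⟨g, ?_, hgf⟩
  have hd : ∀ x, x ∉ S → HasDerivAt g (g' x) x := fun x hx ↦ by
    rw [hgf' x hx]
    refine (h.hasDerivAt hx).congr_of_eventuallyEq ?_
    filter_upwards [(isOpen_compl_finset S).mem_nhds (show x ∈ (S : Set ℝ)ᶜ by simpa using hx)]
      with y hy
    exact hgf y (by simpa using hy)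
  have hint : ∀ x, g x = g 0 + ∫ y in (0 : ℝ)..x, g' y := fun x ↦ by
    rw [integral_eq_of_hasDerivAt_off_countable g g' S.countable_toSet hg.continuousOn
      (fun y hy ↦ hd y (by simpa using hy.2)) (hg'.intervalIntegrable _ _)]
    ring
  have hD : ∀ x, HasDerivAt g (g' x) x := fun x ↦ by
    have := (intervalIntegral.integral_hasDerivAt_right (hg'.intervalIntegrable 0 x)
      hg'.stronglyMeasurable.stronglyMeasurableAtFilter hg'.continuousAt).const_add (g 0)
    exact this.congr_of_eventuallyEq (Eventually.of_forall hint)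
  rw [contDiff_one_iff_deriv]
  refine ⟨fun x ↦ (hD x).differentiableAt, ?_⟩
  rwa [show _root_.deriv g = g' from funext fun x ↦ (hD x).deriv]

/-! ### The derivative of a piecewise smooth function -/

theorem tendsto_heaviside_right (s x : ℝ) :
    Tendsto (fun y ↦ heaviside (y - s)) (𝓝[>] x) (𝓝 (if s ≤ x then 1 else 0)) := by
  refine tendsto_const_nhds.congr' ?_
  split_ifs with h
  · filter_upwards [self_mem_nhdsWithin] with y (hy : x < y)
    rw [heaviside, if_pos (by linarith)]
  · filter_upwards [mem_nhdsWithin_of_mem_nhds (Iio_mem_nhds (not_le.1 h))] with y (hy : y < s)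
    rw [heaviside, if_neg (by linarith)]

theorem tendsto_heaviside_left (s x : ℝ) :
    Tendsto (fun y ↦ heaviside (y - s)) (𝓝[<] x) (𝓝 (if s < x then 1 else 0)) := by
  refine tendsto_const_nhds.congr' ?_
  split_ifs with h
  · filter_upwards [mem_nhdsWithin_of_mem_nhds (Ioi_mem_nhds h)] with y (hy : s < y)
    rw [heaviside, if_pos (by linarith)]
  · filter_upwards [self_mem_nhdsWithin] with y (hy : y < x)
    rw [heaviside, if_neg (by linarith)]

theorem hasDerivAt_heaviside {s x : ℝ} (h : x ≠ s) :
    HasDerivAt (fun y ↦ heaviside (y - s)) 0 x := by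
  rcases lt_or_gt_of_ne h with h | h
  · refine (hasDerivAt_const x (0 : ℂ)).congr_of_eventuallyEq ?_
    filter_upwards [Iio_mem_nhds h] with y (hy : y < s)
    rw [heaviside, if_neg (by linarith)]
  · refine (hasDerivAt_const x (1 : ℂ)).congr_of_eventuallyEq ?_
    filter_upwards [Ioi_mem_nhds h] with y (hy : s < y)
    rw [heaviside, if_pos (by linarith)]

theorem integral_deriv_mul_heaviside (t : Test) (s : ℝ) :
    ∫ x, deriv t x * heaviside (x - s) = -t s := by
  rw [← t.hasCompactSupport.integral_Ioi_deriv_eq (t.contDiff.of_le (by exact_mod_cast le_top)) s,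
    ← integral_indicator measurableSet_Ioi]
  congr 1; ext x
  by_cases h : s < x
  · rw [indicator_of_mem (show x ∈ Ioi s from h), heaviside, if_pos (by linarith), mul_one]
  · rw [indicator_of_notMem (by simpa using h), heaviside, if_neg (by linarith), mul_zero]

theorem locallyIntegrable_heaviside (s : ℝ) :
    LocallyIntegrable (fun x ↦ heaviside (x - s)) := by
  refine LocBdd.locallyIntegrable ⟨?_, fun x ↦ ⟨1, Eventually.of_forall fun y ↦ ?_⟩⟩
  · refine Measurable.aestronglyMeasurable ?_
    exact Measurable.ite (measurableSet_lt measurable_const (measurable_id.sub_const s))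
      measurable_const measurable_const
  · rw [heaviside]; split_ifs <;> simp

/-- Integration by parts for a continuous function which is differentiable off a finite set. -/
theorem integral_deriv_mul_of_continuous {S : Finset ℝ} {g g' : ℝ → ℂ} (hg : Continuous g)
    (hg' : LocallyIntegrable g') (hd : ∀ x, x ∉ S → HasDerivAt g (g' x) x) (t : Test) :
    ∫ x, deriv t x * g x = -∫ x, t x * g' x := by
  have htd : ∀ x, HasDerivAt t (deriv t x) x := fun x ↦
    (((test_contDiff t).differentiable (by simp)) x).hasDerivAt
  have i1 : Integrable fun x ↦ deriv t x * g x := by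
    have := integrable_test_mul hg.locallyIntegrable (TestFunction.lineDerivCLM ℂ (1 : ℝ) t)
    rwa [coe_lineDeriv] at this
  have i2 := integrable_test_mul hg' t
  obtain ⟨R, hR⟩ := t.hasCompactSupport.isBounded.subset_closedBall (0 : ℝ)
  have hz : ∀ x, x ∉ Ioc (-(|R| + 1)) (|R| + 1) → x ∉ tsupport t := fun x hx hxt ↦ by
    have := hR hxt
    rw [Metric.mem_closedBall, Real.dist_eq, sub_zero] at this
    have h2 := abs_le.1 (this.trans (le_abs_self R))
    exact hx ⟨by linarith, by linarith⟩
  have hz' : ∀ x, x ∉ Ioc (-(|R| + 1)) (|R| + 1) → deriv t x * g x + t x * g' x = 0 := fun x hx ↦ by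
    rw [image_eq_zero_of_notMem_tsupport (hz x hx), ← iteratedDeriv_one,
      iteratedDeriv_eq_zero_of_notMem_tsupport (hz x hx)]
    ring
  have hpos : -(|R| + 1) ≤ |R| + 1 := by linarith [abs_nonneg R]
  have key : ∫ x, (deriv t x * g x + t x * g' x) = 0 := by
    rw [← setIntegral_eq_integral_of_forall_compl_eq_zero hz',
      ← intervalIntegral.integral_of_le hpos]
    rw [integral_eq_of_hasDerivAt_off_countable (fun x ↦ t x * g x) _ S.countable_toSet
      (t.continuous.mul hg).continuousOn
      (fun x hx ↦ (htd x).mul (hd x (by simpa using hx.2)))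
      (i1.add i2).intervalIntegrable]
    have e : ∀ x : ℝ, |R| + 1 ≤ |x| → t x = 0 := fun x hx ↦ by
      refine image_eq_zero_of_notMem_tsupport fun hxt ↦ ?_
      have := hR hxt
      rw [Metric.mem_closedBall, Real.dist_eq, sub_zero] at this
      linarith [le_abs_self R]
    rw [e _ (le_abs_self _), e (-(|R| + 1)) (by rw [abs_neg]; exact le_abs_self _)]
    ring
  rw [integral_add i1 i2] at key
  exact eq_neg_of_add_eq_zero_left key

/-- The distributional derivative of `f` is `f'` plus the jumps of `f` times Dirac measures. -/
theorem PSOn.integral_deriv_mul {S : Finset ℝ} {f : ℝ → ℂ} (h : PSOn S f) (t : Test) :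
    -∫ x, _root_.deriv t x * f x =
      (∫ x, t x * _root_.deriv f x) + ∑ s ∈ S, (rlim f s - llim f s) * t s := by
  -- Removing the jumps by Heaviside functions leaves a continuous function.
  obtain ⟨g, hg, hgf⟩ := exists_continuous_of_no_jump (S := S)
    (f := fun x ↦ f x - ∑ s ∈ S, (rlim f s - llim f s) * heaviside (x - s))
    (fun x hx ↦ by
      refine (h.continuousAt hx).sub (tendsto_finsetSum _ fun s hs ↦ ?_)
      exact (hasDerivAt_heaviside (ne_of_mem_of_not_mem hs hx).symm).continuousAt.tendsto.const_mul _)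
    (fun x hx ↦ by
      refine ⟨_, (h.tendsto_llim x).sub (tendsto_finsetSum _ fun s hs ↦
        (tendsto_heaviside_left s x).const_mul _), ?_⟩
      have h2 := (h.tendsto_rlim x).sub (tendsto_finsetSum S fun s hs ↦
        (tendsto_heaviside_right s x).const_mul (rlim f s - llim f s))
      convert h2 using 2
      rw [← Finset.add_sum_erase _ _ hx, ← Finset.add_sum_erase S (fun s ↦ _ * ite (s ≤ x) _ _) hx]
      have : ∀ s ∈ S.erase x, (rlim f s - llim f s) * (if s < x then (1 : ℂ) else 0) =
          (rlim f s - llim f s) * (if s ≤ x then 1 else 0) := fun s hs ↦ by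
        have hne := Finset.ne_of_mem_erase hs
        simp [lt_iff_le_and_ne, hne]
      rw [Finset.sum_congr rfl this]
      simp only [lt_irrefl, le_refl, if_true, if_false]
      ring)
  have hd : ∀ x, x ∉ S → HasDerivAt g (_root_.deriv f x) x := fun x hx ↦ by
    have h1 := (h.hasDerivAt hx).sub (HasDerivAt.fun_sum (u := S) fun s hs ↦
      (hasDerivAt_heaviside (ne_of_mem_of_not_mem hs hx).symm).const_mul (rlim f s - llim f s))
    simp only [mul_zero, Finset.sum_const_zero, sub_zero] at h1
    refine h1.congr_of_eventuallyEq ?_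
    filter_upwards [(isOpen_compl_finset S).mem_nhds (show x ∈ (S : Set ℝ)ᶜ by simpa using hx)]
      with y hy
    exact hgf y (by simpa using hy)
  have e1 := integral_deriv_mul_of_continuous hg h.deriv.locallyIntegrable hd t
  have e2 : ∫ x, _root_.deriv t x * f x = ∫ x, (_root_.deriv t x * g x +
      ∑ s ∈ S, (rlim f s - llim f s) * (_root_.deriv t x * heaviside (x - s))) := by
    refine integral_congr_ae ?_
    filter_upwards [ae_notMem_finset S] with x hx
    rw [hgf x hx, mul_sub, Finset.mul_sum]
    simp only [mul_left_comm (_root_.deriv t x)]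
    ring
  have hi : ∀ {u : ℝ → ℂ}, LocallyIntegrable u → Integrable fun x ↦ _root_.deriv t x * u x :=
    fun hu ↦ by
      have := integrable_test_mul hu (TestFunction.lineDerivCLM ℂ (1 : ℝ) t)
      rwa [coe_lineDeriv] at this
  rw [e2, integral_add (hi hg.locallyIntegrable) (integrable_finsetSum _ fun s _ ↦
    (hi (locallyIntegrable_heaviside s)).const_mul _), e1, integral_finsetSum _ fun s _ ↦
    (hi (locallyIntegrable_heaviside s)).const_mul _]
  simp only [integral_const_mul, integral_deriv_mul_heaviside]
  simp [Finset.sum_neg_distrib]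
  ring

/-- The coefficients of the derivative of a distribution with regular part `f` and coefficients
`c`: the coefficients are shifted, and the jumps of `f` become coefficients of Dirac measures. -/
def derivCoeff (f : ℝ → ℂ) (c : ℝ → ℕ → ℂ) (s : ℝ) : ℕ → ℂ
  | 0 => rlim f s - llim f s
  | j + 1 => c s j

theorem IsRep.D {S : Finset ℝ} {F : Distr} {f : ℝ → ℂ} {c : ℝ → ℕ → ℂ} (h : IsRep S F f c)
    (hf : PSOn S f) : IsRep S (D F) (deriv f) (derivCoeff f c) := by
  obtain ⟨N, hN, hF⟩ := h.exists_eq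
  refine ⟨hf.deriv.locallyIntegrable, N + 1, fun s j hj ↦ ?_, ?_⟩
  · obtain ⟨j, rfl⟩ : ∃ i, j = i + 1 := ⟨j - 1, by omega⟩
    exact hN s j (by omega)
  · ext t
    rw [hF, D_apply, rep_apply h.1, rep_apply hf.deriv.locallyIntegrable, coe_lineDeriv, neg_add,
      hf.integral_deriv_mul]
    simp only [Finset.sum_range_succ', derivCoeff, Finset.sum_add_distrib, pow_succ,
      iteratedDeriv_succ']
    simp [Finset.sum_neg_distrib]
    ring

/-! ### The star product of two distributions in `𝒜` -/

/-- Near a point of smoothness, a function agrees with one that is smooth on `ℝ`, as the factors of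
the Hörmander product have to be: cut it off. -/
theorem exists_smooth_eqOn {O : Set ℝ} (hO : IsOpen O) {f : ℝ → ℂ} (hf : ContDiffOn ℝ ∞ f O)
    {x : ℝ} (hx : x ∈ O) :
    ∃ U, IsOpen U ∧ x ∈ U ∧ U ⊆ O ∧ ∃ g : ℝ → ℂ, ContDiff ℝ ∞ g ∧ EqOn g f U := by
  obtain ⟨r, hr, hrO⟩ := Metric.nhds_basis_closedBall.mem_iff.1 (hO.mem_nhds hx)
  let b : ContDiffBump x := ⟨r / 2, r, half_pos hr, half_lt_self hr⟩
  refine ⟨Metric.ball x (r / 2), Metric.isOpen_ball, Metric.mem_ball_self (half_pos hr),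
    (Metric.ball_subset_closedBall.trans (Metric.closedBall_subset_closedBall (by linarith))).trans
      hrO, fun y ↦ b y • f y, ?_, fun y hy ↦ ?_⟩
  · rw [contDiff_iff_contDiffAt]
    intro y
    by_cases hy : y ∈ O
    · exact b.contDiff.contDiffAt.smul (hf.contDiffAt (hO.mem_nhds hy))
    · have hyb : y ∉ tsupport b := fun h ↦ hy (hrO (b.tsupport_eq ▸ h))
      refine (contDiffAt_const (c := (0 : ℂ))).congr_of_eventuallyEq ?_
      filter_upwards [notMem_tsupport_iff_eventuallyEq.1 hyb] with z hz
      rw [hz]; simp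
  · simp only
    rw [b.one_of_mem_closedBall (Metric.ball_subset_closedBall hy), one_smul]

/-- The coefficients of the product of `∑_{j < N} c_j δ_s^{(j)}` and a smooth function whose
derivatives at `s` are `u_i`, from the Leibniz rule. -/
def mulCoeff (N : ℕ) (c u : ℕ → ℂ) (k : ℕ) : ℂ :=
  ∑ j ∈ Finset.range N, (j.choose k : ℂ) * (-1) ^ (j + k) * u (j - k) * c j

theorem mulCoeff_eq_zero {N k : ℕ} (h : N ≤ k) (c u : ℕ → ℂ) : mulCoeff N c u k = 0 :=
  Finset.sum_eq_zero fun j hj ↦ by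
    rw [Nat.choose_eq_zero_of_lt ((Finset.mem_range.1 hj).trans_le h)]; simp

/-- The top coefficient is multiplied by the value of the smooth function. -/
theorem mulCoeff_top {N m : ℕ} {c : ℕ → ℂ} (hN : ∀ j, N ≤ j → c j = 0) (hm : ∀ j, m < j → c j = 0)
    (u : ℕ → ℂ) : mulCoeff N c u m = c m * u 0 := by
  by_cases h : m < N
  · rw [mulCoeff, Finset.sum_eq_single_of_mem m (Finset.mem_range.2 h)]
    · simp [← two_mul, mul_comm]
    · intro j _ hj
      rcases lt_or_gt_of_ne hj with hj | hj
      · simp [Nat.choose_eq_zero_of_lt hj]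
      · simp [hm j hj]
  · rw [mulCoeff_eq_zero (not_lt.1 h), hN m (not_lt.1 h), zero_mul]

/-- The Leibniz rule, tested against `t`. -/
theorem sum_iteratedDeriv_mul {t u : ℝ → ℂ} (ht : ContDiff ℝ ∞ t) (hu : ContDiff ℝ ∞ u) (N : ℕ)
    (c : ℕ → ℂ) (s : ℝ) :
    ∑ j ∈ Finset.range N, c j * ((-1) ^ j * iteratedDeriv j (fun x ↦ t x * u x) s) =
      ∑ k ∈ Finset.range N, mulCoeff N c (fun i ↦ iteratedDeriv i u s) k *
        ((-1) ^ k * iteratedDeriv k t s) := by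
  simp only [mulCoeff, Finset.sum_mul]
  rw [Finset.sum_comm]
  refine Finset.sum_congr rfl fun j hj ↦ ?_
  have h := iteratedDeriv_mul (n := j) (x := s) (f := t) (g := u)
    (ht.contDiffAt.of_le (by exact_mod_cast le_top))
    (hu.contDiffAt.of_le (by exact_mod_cast le_top))
  rw [show (fun x ↦ t x * u x) = t * u from rfl, h, Finset.mul_sum, Finset.mul_sum]
  have hsub : Finset.range (j + 1) ⊆ Finset.range N :=
    Finset.range_mono (Finset.mem_range.1 hj)
  rw [← Finset.sum_subset hsub fun k _ hk ↦ by
    rw [Nat.choose_eq_zero_of_lt (by simpa using hk)]; simp]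
  refine Finset.sum_congr rfl fun k _ ↦ ?_
  have : ((-1 : ℂ) ^ k) * (-1) ^ k = 1 := by rw [← mul_pow]; simp
  rw [pow_add]
  linear_combination (-(c j * (-1) ^ j * (j.choose k : ℂ) * iteratedDeriv k t s *
    iteratedDeriv (j - k) u s)) * this

theorem point_sum_eq_zero {S : Finset ℝ} {N : ℕ} (c : ℝ → ℕ → ℂ) {p : ℝ → ℝ} {U : Set ℝ}
    (hp : ∀ s ∈ S, p s ∉ U) {t : ℝ → ℂ} (ht : tsupport t ⊆ U) :
    ∑ s ∈ S, ∑ j ∈ Finset.range N, c s j * ((-1) ^ j * iteratedDeriv j t (p s)) = 0 :=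
  Finset.sum_eq_zero fun s hs ↦ Finset.sum_eq_zero fun j _ ↦ by
    rw [iteratedDeriv_eq_zero_of_notMem_tsupport (fun h ↦ hp s hs (ht h))]; simp

theorem point_sum_mul {S : Finset ℝ} {N : ℕ} (c : ℝ → ℕ → ℂ) (p : ℝ → ℝ) {U : Set ℝ}
    (hU : IsOpen U) {t u h : ℝ → ℂ} (ht : ContDiff ℝ ∞ t) (hu : ContDiff ℝ ∞ u) (huh : EqOn u h U)
    (hts : tsupport t ⊆ U) :
    ∑ s ∈ S, ∑ j ∈ Finset.range N,
        c s j * ((-1) ^ j * iteratedDeriv j (fun x ↦ t x * u x) (p s)) =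
      ∑ s ∈ S, ∑ k ∈ Finset.range N, mulCoeff N (c s) (fun i ↦ iteratedDeriv i h (p s)) k *
        ((-1) ^ k * iteratedDeriv k t (p s)) := by
  refine Finset.sum_congr rfl fun s _ ↦ ?_
  rw [sum_iteratedDeriv_mul ht hu]
  by_cases hs : p s ∈ U
  · have : ∀ i, iteratedDeriv i u (p s) = iteratedDeriv i h (p s) := fun i ↦
      EventuallyEq.iteratedDeriv_eq i (huh.eventuallyEq_of_mem (hU.mem_nhds hs))
    simp only [this]
  · have : ∀ k, iteratedDeriv k t (p s) = 0 := fun k ↦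
      iteratedDeriv_eq_zero_of_notMem_tsupport (fun h ↦ hs (hts h)) k
    simp only [this, mul_zero, Finset.sum_const_zero]

theorem integral_congr_of_eqOn {U : Set ℝ} {t u h v : ℝ → ℂ} (huh : EqOn u h U)
    (hts : tsupport t ⊆ U) : ∫ x, t x * (u x * v x) = ∫ x, t x * (h x * v x) := by
  congr 1; ext x
  by_cases hx : x ∈ tsupport t
  · rw [huh (hts hx)]
  · rw [image_eq_zero_of_notMem_tsupport hx, zero_mul, zero_mul]

theorem shift_rep_apply {S : Finset ℝ} {N : ℕ} {g : ℝ → ℂ} (hg : LocallyIntegrable g)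
    (d : ℝ → ℕ → ℂ) (ε : ℝ) (t : Test) :
    shift ε (rep S N g d) t = (∫ x, t x * g (x + ε)) +
      ∑ s ∈ S, ∑ j ∈ Finset.range N, d s j * ((-1) ^ j * iteratedDeriv j t (s - ε)) := by
  rw [shift_apply, rep_apply hg]
  congr 1
  · rw [← integral_sub_right_eq_self (fun x ↦ t x * g (x + ε)) ε]
    congr 1; ext x; rw [shiftTest_apply, sub_add_cancel]
  · refine Finset.sum_congr rfl fun s _ ↦ Finset.sum_congr rfl fun j _ ↦ ?_
    have : ((shiftTest ε t : Test) : ℝ → ℂ) = fun x ↦ t (x - ε) := rfl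
    rw [this, iteratedDeriv_comp_sub_const]

/-- The product `F(x) · G(x + ε)` of `F = f + ∑ c_{s,j} δ_s^{(j)}` and
`G = g + ∑ d_{s,j} δ_s^{(j)}`, when `S` and `S - ε` are disjoint. -/
def shiftedProd (S : Finset ℝ) (N : ℕ) (f g : ℝ → ℂ) (c d : ℝ → ℕ → ℂ) (ε : ℝ) : Distr :=
  regular (fun x ↦ f x * g (x + ε)) +
    ∑ s ∈ S, ∑ k ∈ Finset.range N,
      mulCoeff N (c s) (fun i ↦ iteratedDeriv i g (s + ε)) k • D^[k] (dirac s) +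
    ∑ s ∈ S, ∑ k ∈ Finset.range N,
      mulCoeff N (d s) (fun i ↦ iteratedDeriv i f (s - ε)) k • D^[k] (dirac (s - ε))

theorem shiftedProd_apply {S : Finset ℝ} {f g : ℝ → ℂ} (hf : PSOn S f) (hg : PSOn S g) (N : ℕ)
    (c d : ℝ → ℕ → ℂ) (ε : ℝ) (t : Test) :
    shiftedProd S N f g c d ε t = (∫ x, t x * (f x * g (x + ε))) +
      (∑ s ∈ S, ∑ k ∈ Finset.range N, mulCoeff N (c s) (fun i ↦ iteratedDeriv i g (s + ε)) k *
        ((-1) ^ k * iteratedDeriv k t s)) +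
      ∑ s ∈ S, ∑ k ∈ Finset.range N, mulCoeff N (d s) (fun i ↦ iteratedDeriv i f (s - ε)) k *
        ((-1) ^ k * iteratedDeriv k t (s - ε)) := by
  simp only [shiftedProd, add_apply, sum_apply, smul_apply, smul_eq_mul, D_iterate_dirac_apply,
    regular_apply (hf.locBdd.mul (hg.locBdd.comp_add ε)).locallyIntegrable]

theorem coe_mulTest (g : ℝ → ℂ) (hg : ContDiff ℝ ∞ g) (t : Test) :
    (mulTest g hg t : ℝ → ℂ) = fun x ↦ t x * g x := rfl

/-- Near a point of `S` the factor `G(x + ε)` is smooth, and elsewhere `F` is. -/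
theorem isHormanderProd_shiftedProd {S : Finset ℝ} {f g : ℝ → ℂ} (hf : PSOn S f) (hg : PSOn S g)
    (N : ℕ) (c d : ℝ → ℕ → ℂ) {ε : ℝ} (hε : ∀ s ∈ S, s + ε ∉ S) :
    IsHormanderProd (rep S N f c) (shift ε (rep S N g d)) (shiftedProd S N f g c d ε) := by
  have hfl := hf.locallyIntegrable
  have hgl := hg.locallyIntegrable
  intro x
  by_cases hx : x ∈ S
  · have hO : IsOpen {y : ℝ | y + ε ∉ S} :=
      (isOpen_compl_finset S).preimage (continuous_add_const ε)
    have hgO : ContDiffOn ℝ ∞ (fun y ↦ g (y + ε)) {y : ℝ | y + ε ∉ S} :=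
      hg.contDiffOn.comp (contDiff_id.add contDiff_const).contDiffOn (fun y hy ↦ hy)
    obtain ⟨U, hU, hxU, hUO, u, hu, huU⟩ := exists_smooth_eqOn hO hgO (hε x hx)
    have hp : ∀ s ∈ S, s - ε ∉ U := fun s hs h ↦ hUO h (by simpa using hs)
    refine ⟨U, hU, hxU, u, hu, Or.inr ⟨fun t ht ↦ ?_, fun t ht ↦ ?_⟩⟩
    · rw [shift_rep_apply hgl, point_sum_eq_zero d hp ht, add_zero,
        regular_apply hu.continuous.locallyIntegrable]
      simpa using (integral_congr_of_eqOn (v := fun _ ↦ 1) huU ht).symm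
    · rw [shiftedProd_apply hf hg, point_sum_eq_zero _ hp ht, add_zero, smoothMul_apply,
        rep_apply hfl, coe_mulTest, point_sum_mul c (fun s ↦ s) hU (test_contDiff t) hu huU ht]
      congr 1
      · simp only [mul_assoc]
        rw [integral_congr_of_eqOn huU ht]
        simp only [mul_comm]
      · simp only [iteratedDeriv_comp_add_const]
  · obtain ⟨U, hU, hxU, hUO, u, hu, huU⟩ := exists_smooth_eqOn (isOpen_compl_finset S)
      hf.contDiffOn (show x ∈ (S : Set ℝ)ᶜ by simpa using hx)
    have hp : ∀ s ∈ S, (fun s : ℝ ↦ s) s ∉ U := fun s hs h ↦ hUO h (by simpa using hs)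
    refine ⟨U, hU, hxU, u, hu, Or.inl ⟨fun t ht ↦ ?_, fun t ht ↦ ?_⟩⟩
    · rw [rep_apply hfl, point_sum_eq_zero c hp ht, add_zero,
        regular_apply hu.continuous.locallyIntegrable]
      simpa using (integral_congr_of_eqOn (v := fun _ ↦ 1) huU ht).symm
    · rw [shiftedProd_apply hf hg, point_sum_eq_zero _ hp ht, add_zero, smoothMul_apply,
        shift_rep_apply hgl, coe_mulTest,
        point_sum_mul d (fun s ↦ s - ε) hU (test_contDiff t) hu huU ht]
      congr 1
      simp only [mul_assoc]
      rw [integral_congr_of_eqOn huU ht]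

theorem eventually_disjoint_translate (S : Finset ℝ) :
    ∀ᶠ ε in 𝓝[>] (0 : ℝ), ∀ s ∈ S, s + ε ∉ S := by
  have h : ∀ᶠ ε in 𝓝[>] (0 : ℝ), ∀ s ∈ S, ∀ s' ∈ S, s + ε ≠ s' := by
    rw [Finset.eventually_all]
    intro s _
    rw [Finset.eventually_all]
    intro s' _
    by_cases hs : s < s'
    · filter_upwards [Ioo_mem_nhdsGT (sub_pos.2 hs)] with ε hε h
      linarith [hε.2]
    · filter_upwards [self_mem_nhdsWithin] with ε (hε : 0 < ε) h
      linarith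
  filter_upwards [h] with ε hε s hs hs'
  exact hε s hs _ hs' rfl

theorem tendsto_add_nhdsGT (s : ℝ) : Tendsto (fun ε ↦ s + ε) (𝓝[>] 0) (𝓝[>] s) := by
  refine tendsto_nhdsWithin_iff.2 ⟨?_, ?_⟩
  · have : Tendsto (fun ε : ℝ ↦ s + ε) (𝓝 0) (𝓝 (s + 0)) := (continuous_const_add s).tendsto 0
    rw [add_zero] at this
    exact this.mono_left nhdsWithin_le_nhds
  · filter_upwards [self_mem_nhdsWithin] with ε (hε : 0 < ε)
    simpa using hε

theorem tendsto_sub_nhdsLT (s : ℝ) : Tendsto (fun ε ↦ s - ε) (𝓝[>] 0) (𝓝[<] s) := by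
  refine tendsto_nhdsWithin_iff.2 ⟨?_, ?_⟩
  · have : Tendsto (fun ε : ℝ ↦ s - ε) (𝓝 0) (𝓝 (s - 0)) := (continuous_const.sub continuous_id).tendsto 0
    rw [sub_zero] at this
    exact this.mono_left nhdsWithin_le_nhds
  · filter_upwards [self_mem_nhdsWithin] with ε (hε : 0 < ε)
    simpa using hε

theorem tendsto_mulCoeff {N : ℕ} {c : ℕ → ℂ} {u : ℝ → ℕ → ℂ} {v : ℕ → ℂ} {l : Filter ℝ}
    (h : ∀ i, Tendsto (fun ε ↦ u ε i) l (𝓝 (v i))) (k : ℕ) :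
    Tendsto (fun ε ↦ mulCoeff N c (u ε) k) l (𝓝 (mulCoeff N c v k)) :=
  tendsto_finsetSum _ fun j _ ↦ ((h (j - k)).const_mul _).mul_const _

theorem tendsto_integral_mul_translate {S : Finset ℝ} {f g : ℝ → ℂ} (hf : PSOn S f)
    (hg : PSOn S g) (t : Test) :
    Tendsto (fun ε ↦ ∫ x, t x * (f x * g (x + ε))) (𝓝[>] 0) (𝓝 (∫ x, t x * (f x * g x))) := by
  have hK : IsCompact (tsupport t) := t.hasCompactSupport
  obtain ⟨C, hC0, hC⟩ := hf.locBdd.exists_bound hK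
  obtain ⟨C', hC0', hC'⟩ := hg.locBdd.exists_bound
    ((hK.prod (isCompact_Icc (a := (0 : ℝ)) (b := 1))).image continuous_add)
  refine tendsto_integral_filter_of_dominated_convergence (fun x ↦ ‖t x‖ * (C * C')) ?_ ?_ ?_ ?_
  · exact Eventually.of_forall fun ε ↦ t.continuous.aestronglyMeasurable.mul
      (hf.locBdd.mul (hg.locBdd.comp_add ε)).measurable
  · filter_upwards [Ioo_mem_nhdsGT (zero_lt_one' ℝ)] with ε hε
    refine Eventually.of_forall fun x ↦ ?_
    by_cases hx : x ∈ tsupport t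
    · rw [norm_mul, norm_mul]
      have := hC' (x + ε) ⟨(x, ε), ⟨hx, hε.1.le, hε.2.le⟩, rfl⟩
      exact mul_le_mul_of_nonneg_left (mul_le_mul (hC x hx) this (norm_nonneg _) hC0)
        (norm_nonneg _)
    · rw [image_eq_zero_of_notMem_tsupport hx]; simp
  · exact (t.continuous.norm.integrable_of_hasCompactSupport t.hasCompactSupport.norm).mul_const _
  · filter_upwards [ae_notMem_finset S] with x hx
    exact (((hg.continuousAt hx).tendsto.comp
      ((tendsto_add_nhdsGT x).mono_right nhdsWithin_le_nhds)).const_mul _).const_mul _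

theorem isStarProd_rep {S : Finset ℝ} {f g : ℝ → ℂ} (hf : PSOn S f) (hg : PSOn S g)
    (N : ℕ) (c d : ℝ → ℕ → ℂ) :
    IsStarProd (rep S N f c) (rep S N g d) (rep S N (fun x ↦ f x * g x) fun s k ↦
      mulCoeff N (c s) (fun i ↦ rlim (iteratedDeriv i g) s) k +
        mulCoeff N (d s) (fun i ↦ llim (iteratedDeriv i f) s) k) := by
  refine ⟨shiftedProd S N f g c d, ?_, fun t ↦ ?_⟩
  · filter_upwards [eventually_disjoint_translate S] with ε hε
    exact isHormanderProd_shiftedProd hf hg N c d hε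
  · simp only [shiftedProd_apply hf hg, rep_apply (hf.locBdd.mul hg.locBdd).locallyIntegrable,
      add_mul, Finset.sum_add_distrib, ← add_assoc]
    refine ((tendsto_integral_mul_translate hf hg t).add ?_).add ?_
    · exact tendsto_finsetSum _ fun s _ ↦ tendsto_finsetSum _ fun k _ ↦ (tendsto_mulCoeff
        (fun i ↦ ((hg.iteratedDeriv i).tendsto_rlim s).comp (tendsto_add_nhdsGT s)) k).mul_const _
    · refine tendsto_finsetSum _ fun s _ ↦ tendsto_finsetSum _ fun k _ ↦ (tendsto_mulCoeff
        (fun i ↦ ((hf.iteratedDeriv i).tendsto_llim s).comp (tendsto_sub_nhdsLT s)) k).mul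
        (Tendsto.const_mul _ ?_)
      exact (((test_contDiff t).continuous_iteratedDeriv k
        (by exact_mod_cast le_top)).tendsto s).comp
        ((tendsto_sub_nhdsLT s).mono_right nhdsWithin_le_nhds)

/-- `F * G` decomposes like `F` and `G`, and its top coefficient at `s` is
`c_m g(s+) + f(s-) d_m`. -/
theorem exists_isRep_starProd {S : Finset ℝ} {F G : Distr} {f g : ℝ → ℂ} {c d : ℝ → ℕ → ℂ}
    (hF : IsRep S F f c) (hf : PSOn S f) (hG : IsRep S G g d) (hg : PSOn S g) :
    ∃ (h : ℝ → ℂ) (e : ℝ → ℕ → ℂ), IsRep S (starProd F G) h e ∧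
      ∀ s m, (∀ j, m < j → c s j = 0) → (∀ j, m < j → d s j = 0) →
        e s m = c s m * rlim g s + llim f s * d s m := by
  obtain ⟨N₁, hN₁⟩ := hF.exists_forall
  obtain ⟨N₂, hN₂⟩ := hG.exists_forall
  obtain ⟨hc, hFr⟩ := hN₁ (max N₁ N₂) (le_max_left _ _)
  obtain ⟨hd, hGr⟩ := hN₂ (max N₁ N₂) (le_max_right _ _)
  refine ⟨_, _, ⟨(hf.locBdd.mul hg.locBdd).locallyIntegrable, max N₁ N₂, fun s j hj ↦ ?_,
    hFr ▸ hGr ▸ (isStarProd_rep hf hg (max N₁ N₂) c d).starProd_eq⟩, fun s m h1 h2 ↦ ?_⟩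
  · rw [mulCoeff_eq_zero hj, mulCoeff_eq_zero hj, add_zero]
  · rw [mulCoeff_top (hc s) h1, mulCoeff_top (hd s) h2, iteratedDeriv_zero, iteratedDeriv_zero,
      mul_comm (d s m)]

/-! ### Elements of `𝒜` and coefficients with a jump -/

/-- The coefficients of the `k`-th derivative of `f + ∑ c_{s,j} δ_s^{(j)}`. -/
def iterCoeff (f : ℝ → ℂ) (c : ℝ → ℕ → ℂ) : ℕ → ℝ → ℕ → ℂ
  | 0 => c
  | k + 1 => derivCoeff (iteratedDeriv k f) (iterCoeff f c k)

theorem iterCoeff_add (f : ℝ → ℂ) (c : ℝ → ℕ → ℂ) (k i : ℕ) (s : ℝ) (j : ℕ) :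
    iterCoeff f c (k + i) s (j + i) = iterCoeff f c k s j := by
  induction i with
  | zero => rfl
  | succ i ih => exact ih

theorem IsRep.D_iterate {S : Finset ℝ} {F : Distr} {f : ℝ → ℂ} {c : ℝ → ℕ → ℂ} (h : IsRep S F f c)
    (hf : PSOn S f) (k : ℕ) : IsRep S (BeamDist.D^[k] F) (iteratedDeriv k f) (iterCoeff f c k) := by
  induction k with
  | zero => rw [iteratedDeriv_zero]; exact h
  | succ k ih =>
    rw [Function.iterate_succ_apply', iteratedDeriv_succ]
    exact ih.D (hf.iteratedDeriv k)

theorem isRep_regular {f : ℝ → ℂ} (hf : LocallyIntegrable f) (S : Finset ℝ) :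
    IsRep S (regular f) f 0 := by
  refine ⟨hf, 0, fun _ _ _ ↦ rfl, ?_⟩
  ext t
  simp [rep]

theorem InA.exists_isRep {φ : Distr} (h : InA φ) (ξ : ℝ) :
    ∃ (S : Finset ℝ) (f : ℝ → ℂ) (c : ℝ → ℕ → ℂ), ξ ∈ S ∧ PSOn S f ∧ IsRep S φ f c := by
  obtain ⟨f, n, hf, rfl⟩ := h
  obtain ⟨S, hS⟩ := hf.exists_psOn
  have hS' := hS.mono (Finset.subset_insert ξ S)
  exact ⟨insert ξ S, _, _, Finset.mem_insert_self ξ S, hS'.iteratedDeriv n,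
    (isRep_regular hS'.locallyIntegrable _).D_iterate hS' n⟩

/-- The function `f₋ H(ξ - x) + f₊ H(x - ξ)`, whose value at `ξ` is `0`. -/
def glue (ξ : ℝ) (fm fp : ℝ → ℂ) (x : ℝ) : ℂ :=
  fm x * heaviside (ξ - x) + fp x * heaviside (x - ξ)

theorem glue_of_lt {ξ : ℝ} (fm fp : ℝ → ℂ) {x : ℝ} (h : x < ξ) : glue ξ fm fp x = fm x := by
  rw [glue, heaviside, heaviside, if_pos (by linarith), if_neg (by linarith)]; ring

theorem glue_of_gt {ξ : ℝ} (fm fp : ℝ → ℂ) {x : ℝ} (h : ξ < x) : glue ξ fm fp x = fp x := by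
  rw [glue, heaviside, heaviside, if_neg (by linarith), if_pos (by linarith)]; ring

theorem glue_eventuallyEq_of_lt {ξ : ℝ} (fm fp : ℝ → ℂ) {x : ℝ} (h : x < ξ) :
    glue ξ fm fp =ᶠ[𝓝 x] fm := by
  filter_upwards [Iio_mem_nhds h] with y hy using glue_of_lt fm fp hy

theorem glue_eventuallyEq_of_gt {ξ : ℝ} (fm fp : ℝ → ℂ) {x : ℝ} (h : ξ < x) :
    glue ξ fm fp =ᶠ[𝓝 x] fp := by
  filter_upwards [Ioi_mem_nhds h] with y hy using glue_of_gt fm fp hy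

theorem tendsto_glue_left {ξ : ℝ} {fm fp : ℝ → ℂ} (hm : Continuous fm) :
    Tendsto (glue ξ fm fp) (𝓝[<] ξ) (𝓝 (fm ξ)) := by
  refine ((hm.tendsto ξ).mono_left nhdsWithin_le_nhds).congr' ?_
  filter_upwards [self_mem_nhdsWithin] with y hy using (glue_of_lt fm fp hy).symm

theorem tendsto_glue_right {ξ : ℝ} {fm fp : ℝ → ℂ} (hp : Continuous fp) :
    Tendsto (glue ξ fm fp) (𝓝[>] ξ) (𝓝 (fp ξ)) := by
  refine ((hp.tendsto ξ).mono_left nhdsWithin_le_nhds).congr' ?_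
  filter_upwards [self_mem_nhdsWithin] with y hy using (glue_of_gt fm fp hy).symm

theorem psOn_glue {ξ : ℝ} {fm fp : ℝ → ℂ} (hm : ContDiff ℝ ∞ fm) (hp : ContDiff ℝ ∞ fp)
    {S : Finset ℝ} (hξ : ξ ∈ S) : PSOn S (glue ξ fm fp) := by
  refine PSOn.mono (S := {ξ}) ⟨fun x hx ↦ ContDiffAt.contDiffWithinAt ?_, fun x hx n ↦ ?_,
    fun x hx n ↦ ?_⟩ (Finset.singleton_subset_iff.2 hξ)
  · rcases lt_or_gt_of_ne (show x ≠ ξ by simpa using hx) with h | h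
    · exact hm.contDiffAt.congr_of_eventuallyEq (glue_eventuallyEq_of_lt fm fp h)
    · exact hp.contDiffAt.congr_of_eventuallyEq (glue_eventuallyEq_of_gt fm fp h)
  · obtain rfl := Finset.mem_singleton.1 hx
    refine ⟨_, (((hm.continuous_iteratedDeriv n (by exact_mod_cast le_top)).tendsto x).mono_left
      nhdsWithin_le_nhds).congr' ?_⟩
    filter_upwards [self_mem_nhdsWithin] with y hy
    exact (EventuallyEq.iteratedDeriv_eq n (glue_eventuallyEq_of_lt fm fp hy)).symm
  · obtain rfl := Finset.mem_singleton.1 hx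
    refine ⟨_, (((hp.continuous_iteratedDeriv n (by exact_mod_cast le_top)).tendsto x).mono_left
      nhdsWithin_le_nhds).congr' ?_⟩
    filter_upwards [self_mem_nhdsWithin] with y hy
    exact (EventuallyEq.iteratedDeriv_eq n (glue_eventuallyEq_of_gt fm fp hy)).symm

theorem llim_glue_add_rlim_glue_ne_zero {ξ : ℝ} {fm fp gm gp : ℝ → ℂ} (hfm : Continuous fm)
    (hfp : Continuous fp) (hgm : Continuous gm) (hgp : Continuous gp) (h0 : fm ξ + gp ξ ≠ 0)
    (hm : ∀ x, fm x + gm x ≠ 0) (hp : ∀ x, fp x + gp x ≠ 0) (s : ℝ) :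
    llim (glue ξ fm fp) s + rlim (glue ξ gm gp) s ≠ 0 := by
  have hlt : ∀ {u v : ℝ → ℂ}, Continuous u → s < ξ → Tendsto (glue ξ u v) (𝓝 s) (𝓝 (u s)) :=
    fun hu h ↦ (hu.tendsto s).congr' (glue_eventuallyEq_of_lt _ _ h).symm
  have hgt : ∀ {u v : ℝ → ℂ}, Continuous v → ξ < s → Tendsto (glue ξ u v) (𝓝 s) (𝓝 (v s)) :=
    fun hv h ↦ (hv.tendsto s).congr' (glue_eventuallyEq_of_gt _ _ h).symm
  rcases lt_trichotomy s ξ with h | rfl | h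
  · rw [llim_eq ((hlt hfm h).mono_left nhdsWithin_le_nhds),
      rlim_eq ((hlt hgm h).mono_left nhdsWithin_le_nhds)]
    exact hm s
  · rw [llim_eq (tendsto_glue_left hfm), rlim_eq (tendsto_glue_right hgp)]
    exact h0
  · rw [llim_eq ((hgt hfp h).mono_left nhdsWithin_le_nhds),
      rlim_eq ((hgt hgp h).mono_left nhdsWithin_le_nhds)]
    exact hp s

theorem exists_isRep_jumpDistr {ξ : ℝ} {fm fp : ℝ → ℂ} (hm : ContDiff ℝ ∞ fm)
    (hp : ContDiff ℝ ∞ fp) {n : ℕ} (c : Fin n → ℂ) {S : Finset ℝ} (hξ : ξ ∈ S) :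
    ∃ d, IsRep S (jumpDistr ξ fm fp c) (glue ξ fm fp) d := by
  refine ⟨fun s j ↦ if s = ξ then (if h : j < n then c ⟨j, h⟩ else 0) else 0,
    (psOn_glue hm hp hξ).locallyIntegrable, n, fun s j hj ↦ by simp [hj.not_gt], ?_⟩
  ext t
  simp only [jumpDistr, rep, add_apply, sum_apply, smul_apply, smul_eq_mul]
  rw [Finset.sum_eq_single_of_mem ξ hξ (fun s _ hs ↦ by simp [hs]), Finset.sum_range]
  simp
  rfl

/-! ### The top coefficient of the beam equation -/

theorem exists_isRep_starProd_add_starProd {S : Finset ℝ} {F G ψ : Distr} {f g u : ℝ → ℂ}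
    {c d e : ℝ → ℕ → ℂ} (hF : IsRep S F f c) (hf : PSOn S f) (hG : IsRep S G g d) (hg : PSOn S g)
    (hψ : IsRep S ψ u e) (hu : PSOn S u) :
    ∃ (h : ℝ → ℂ) (r : ℝ → ℕ → ℂ), IsRep S (starProd F ψ + starProd ψ G) h r ∧
      ∀ s m, (∀ j, m ≤ j → c s j = 0) → (∀ j, m ≤ j → d s j = 0) → (∀ j, m < j → e s j = 0) →
        r s m = (llim f s + rlim g s) * e s m := by
  obtain ⟨h₁, r₁, H₁, hr₁⟩ := exists_isRep_starProd hF hf hψ hu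
  obtain ⟨h₂, r₂, H₂, hr₂⟩ := exists_isRep_starProd hψ hu hG hg
  refine ⟨_, _, H₁.add H₂, fun s m hc hd he ↦ ?_⟩
  rw [Pi.add_apply, Pi.add_apply, hr₁ s m (fun j hj ↦ hc j hj.le) he,
    hr₂ s m he (fun j hj ↦ hd j hj.le), hc m le_rfl, hd m le_rfl]
  ring

theorem iterCoeff_eq_zero {f : ℝ → ℂ} {c : ℝ → ℕ → ℂ} {s : ℝ} {p : ℕ}
    (h : ∀ j, p ≤ j → c s j = 0) (i : ℕ) {j : ℕ} (hj : p + i ≤ j) : iterCoeff f c i s j = 0 := by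
  obtain ⟨k, rfl⟩ : ∃ k, j = k + i := ⟨j - i, by omega⟩
  have := iterCoeff_add f c 0 i s k
  rw [zero_add] at this
  rw [this]
  exact h k (by omega)

/-- If the point parts of the `a_i` have order at most `p` and those of the `b_i` order at most
`p + 2`, then `φ''''` has no `δ_s^{(m)}` with `m ≥ p + 2`: the highest one could only be cancelled
by itself, its coefficient in the equation being multiplied by `a₀(s-) + a₁(s+)`. -/
theorem iterCoeff_four_eq_zero {S : Finset ℝ} {a b : Fin 2 → Distr} {w : ℂ} {φ : Distr}
    {f : ℝ → ℂ} {c : ℝ → ℕ → ℂ} (hφ : IsRep S φ f c) (hf : PSOn S f) (hsol : IsSolution a b w φ)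
    {fa fb : Fin 2 → ℝ → ℂ} {ca cb : Fin 2 → ℝ → ℕ → ℂ} (ha : ∀ i, IsRep S (a i) (fa i) (ca i))
    (hfa : ∀ i, PSOn S (fa i)) (hb : ∀ i, IsRep S (b i) (fb i) (cb i)) (hfb : ∀ i, PSOn S (fb i))
    {p : ℕ} {s : ℝ} (hs : s ∈ S) (hca : ∀ i j, p ≤ j → ca i s j = 0)
    (hcb : ∀ i j, p + 2 ≤ j → cb i s j = 0) (hne : llim (fa 0) s + rlim (fa 1) s ≠ 0)
    {m : ℕ} (hm : p + 2 ≤ m) : iterCoeff f c 4 s m = 0 := by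
  have term : ∀ i, i ≤ 2 → ∃ (h : ℝ → ℂ) (r : ℝ → ℕ → ℂ),
      IsRep S (starProd (D^[i] (a 0)) (D^[4 - i] φ) + starProd (D^[4 - i] φ) (D^[i] (a 1))) h r ∧
      ∀ m, p + 2 ≤ m → (∀ j, m < j → iterCoeff f c 4 s j = 0) →
        r s m = (llim (iteratedDeriv i (fa 0)) s + rlim (iteratedDeriv i (fa 1)) s) *
          iterCoeff f c 4 s (m + i) := fun i hi ↦ by
    obtain ⟨h, r, H, hr⟩ := exists_isRep_starProd_add_starProd
      ((ha 0).D_iterate (hfa 0) i) ((hfa 0).iteratedDeriv i)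
      ((ha 1).D_iterate (hfa 1) i) ((hfa 1).iteratedDeriv i)
      (hφ.D_iterate hf (4 - i)) (hf.iteratedDeriv (4 - i))
    have e4 : ∀ j, iterCoeff f c (4 - i) s j = iterCoeff f c 4 s (j + i) := fun j ↦ by
      have := iterCoeff_add f c (4 - i) i s j
      rw [Nat.sub_add_cancel (by omega)] at this
      exact this.symm
    refine ⟨h, r, H, fun m hm hz ↦ ?_⟩
    rw [hr s m (fun j hj ↦ iterCoeff_eq_zero (hca 0) i (by omega))
      (fun j hj ↦ iterCoeff_eq_zero (hca 1) i (by omega))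
      (fun j hj ↦ by rw [e4]; exact hz _ (by omega)), e4]
  obtain ⟨h₀, r₀, H₀, hr₀⟩ := term 0 (by norm_num)
  obtain ⟨h₁, r₁, H₁, hr₁⟩ := term 1 (by norm_num)
  obtain ⟨h₂, r₂, H₂, hr₂⟩ := term 2 le_rfl
  obtain ⟨h₃, r₃, H₃, hr₃⟩ := exists_isRep_starProd_add_starProd (hb 0) (hfb 0) (hb 1) (hfb 1) hφ hf
  have e0 : ∀ j, c s j = iterCoeff f c 4 s (j + 4) := fun j ↦ (iterCoeff_add f c 0 4 s j).symm
  have H := (((H₀.smul (Nat.choose 2 0 : ℂ)).add (H₁.smul (Nat.choose 2 1 : ℂ))).add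
    (H₂.smul (Nat.choose 2 2 : ℂ))).add (H₃.smul (-w ^ 2))
  have hzero : (Nat.choose 2 0 : ℂ) •
        (starProd (D^[0] (a 0)) (D^[4 - 0] φ) + starProd (D^[4 - 0] φ) (D^[0] (a 1))) +
      (Nat.choose 2 1 : ℂ) •
        (starProd (D^[1] (a 0)) (D^[4 - 1] φ) + starProd (D^[4 - 1] φ) (D^[1] (a 1))) +
      (Nat.choose 2 2 : ℂ) •
        (starProd (D^[2] (a 0)) (D^[4 - 2] φ) + starProd (D^[4 - 2] φ) (D^[2] (a 1))) +
      (-w ^ 2) • (starProd (b 0) φ + starProd φ (b 1)) = 0 := by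
    rw [← hsol.2, Finset.sum_range_succ, Finset.sum_range_succ, Finset.sum_range_one]
    ext t
    simp only [add_apply, sub_apply, smul_apply, smul_eq_mul]
    ring
  rw [hzero] at H
  have hc := fun k ↦ H.coeff_eq_zero_of_eq_zero hs k
  simp only [Pi.add_apply, Pi.smul_apply, smul_eq_mul] at hc
  have step : ∀ m, p + 2 ≤ m → (∀ j, m < j → iterCoeff f c 4 s j = 0) →
      iterCoeff f c 4 s m = 0 := fun m hm hz ↦ by
    have h := hc m
    rw [hr₀ m hm hz, hr₁ m hm hz, hr₂ m hm hz,
      hr₃ s m (fun j hj ↦ hcb 0 j (by omega)) (fun j hj ↦ hcb 1 j (by omega))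
        (fun j hj ↦ by rw [e0]; exact hz _ (by omega)), e0, hz (m + 1) (by omega),
      hz (m + 2) (by omega), hz (m + 4) (by omega)] at h
    simpa [hne] using h
  obtain ⟨N, hN, -⟩ := (hφ.D_iterate hf 4).exists_eq
  -- Downward induction from `N`, beyond which all coefficients vanish.
  have main : ∀ k m, p + 2 ≤ m → N ≤ m + k → iterCoeff f c 4 s m = 0 := fun k ↦ by
    induction k with
    | zero => exact fun m _ h ↦ hN s m (by omega)
    | succ k ih => exact fun m hm h ↦ step m hm fun j hj ↦ ih j (by omega) (by omega)
  exact main N m hm (by omega)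

theorem IsRep.eq_regular {S : Finset ℝ} {F : Distr} {f : ℝ → ℂ} {c : ℝ → ℕ → ℂ}
    (h : IsRep S F f c) (hc : ∀ s ∈ S, ∀ j, c s j = 0) : F = regular f := by
  obtain ⟨N, -, hF⟩ := h.exists_eq
  rw [hF, rep, Finset.sum_eq_zero, add_zero]
  refine fun s hs ↦ Finset.sum_eq_zero fun j _ ↦ ?_
  ext t
  simp [hc s hs j]

end BeamDist

end

theorem corollary3p3 (ξ₀ : ℝ) (w : ℂ)
    (am ap bm bp : Fin 2 → ℝ → ℂ)
    (ham : ∀ i, ContDiff ℝ ∞ (am i)) (hap : ∀ i, ContDiff ℝ ∞ (ap i))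
    (hbm : ∀ i, ContDiff ℝ ∞ (bm i)) (hbp : ∀ i, ContDiff ℝ ∞ (bp i))
    (A : Fin 2 → Fin 2 → ℂ) (B : Fin 2 → Fin 4 → ℂ)
    (a b : Fin 2 → BeamDist.Distr)
    (ha : ∀ i, a i = BeamDist.jumpDistr ξ₀ (am i) (ap i) (A i))
    (hb : ∀ i, b i = BeamDist.jumpDistr ξ₀ (bm i) (bp i) (B i))
    (hC1 : am 0 ξ₀ + ap 1 ξ₀ ≠ 0)
    (hC2m : ∀ x, am 0 x + am 1 x ≠ 0)
    (hC2p : ∀ x, ap 0 x + ap 1 x ≠ 0) :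
    ((∀ i, BeamDist.ord (a i) ≤ 1) → (∀ i, BeamDist.ord (b i) ≤ 3) →
      ∀ φ : BeamDist.Distr, BeamDist.IsSolution a b w φ →
        ∃ f : ℝ → ℂ, Continuous f ∧ φ = BeamDist.regular f) ∧
    ((∀ i, BeamDist.ord (a i) = 0) → (∀ i, BeamDist.ord (b i) ≤ 2) →
      ∀ φ : BeamDist.Distr, BeamDist.IsSolution a b w φ →
        ∃ f : ℝ → ℂ, ContDiff ℝ 1 f ∧ φ = BeamDist.regular f) := by
  have key : ∀ p : ℕ, (∀ i, BeamDist.ord (a i) ≤ p) → (∀ i, BeamDist.ord (b i) ≤ (p + 2 : ℕ)) →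
      ∀ φ, BeamDist.IsSolution a b w φ → ∃ (S : Finset ℝ) (f : ℝ → ℂ) (c : ℝ → ℕ → ℂ),
        BeamDist.PSOn S f ∧ BeamDist.IsRep S φ f c ∧
          ∀ s ∈ S, ∀ m, p + 2 ≤ m → BeamDist.iterCoeff f c 4 s m = 0 := by
    intro p hpa hpb φ hφ
    obtain ⟨S, f, c, hξ, hf, hr⟩ := hφ.1.exists_isRep ξ₀
    choose ca hca using fun i ↦ BeamDist.exists_isRep_jumpDistr (ham i) (hap i) (A i) hξ
    choose cb hcb using fun i ↦ BeamDist.exists_isRep_jumpDistr (hbm i) (hbp i) (B i) hξ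
    have hra : ∀ i, BeamDist.IsRep S (a i) _ (ca i) := fun i ↦ ha i ▸ hca i
    have hrb : ∀ i, BeamDist.IsRep S (b i) _ (cb i) := fun i ↦ hb i ▸ hcb i
    refine ⟨S, f, c, hf, hr, fun s hs m hm ↦ ?_⟩
    exact BeamDist.iterCoeff_four_eq_zero hr hf hφ hra (fun i ↦ BeamDist.psOn_glue (ham i) (hap i) hξ)
      hrb (fun i ↦ BeamDist.psOn_glue (hbm i) (hbp i) hξ) hs
      (fun i j hj ↦ (hra i).coeff_eq_zero_of_ord_le (hpa i) hs hj)
      (fun i j hj ↦ (hrb i).coeff_eq_zero_of_ord_le (hpb i) hs hj)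
      (BeamDist.llim_glue_add_rlim_glue_ne_zero (ham 0).continuous (hap 0).continuous
        (ham 1).continuous (hap 1).continuous hC1 hC2m hC2p s) hm
  refine ⟨fun ha1 hb3 φ hφ ↦ ?_, fun ha0 hb2 φ hφ ↦ ?_⟩
  · obtain ⟨S, f, c, hf, hr, h⟩ := key 1 (by exact_mod_cast ha1) (by exact_mod_cast hb3) φ hφ
    -- The jump of `f` at `s` is the coefficient of `δ_s` in `φ'`, so that of `δ_s^{(3)}` in `φ''''`.
    obtain ⟨g, hg, hgf⟩ := hf.exists_continuous fun s hs ↦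
      sub_eq_zero.1 ((BeamDist.iterCoeff_add f c 1 3 s 0).symm.trans (h s hs 3 le_rfl))
    refine ⟨g, hg, (hr.eq_regular fun s hs j ↦ ?_).trans
      (BeamDist.regular_congr hf.locallyIntegrable hg.locallyIntegrable hgf)⟩
    exact (BeamDist.iterCoeff_add f c 0 4 s j).symm.trans (h s hs (j + 4) (by omega))
  · obtain ⟨S, f, c, hf, hr, h⟩ := key 0 (fun i ↦ (ha0 i).le) (by exact_mod_cast hb2) φ hφ
    obtain ⟨g, hg, hgf⟩ := hf.exists_contDiff_one
      (fun s hs ↦ sub_eq_zero.1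
        ((BeamDist.iterCoeff_add f c 1 3 s 0).symm.trans (h s hs 3 (by norm_num))))
      (fun s hs ↦ by
        rw [← iteratedDeriv_one]
        exact sub_eq_zero.1
          ((BeamDist.iterCoeff_add f c 2 2 s 0).symm.trans (h s hs 2 le_rfl)))
    refine ⟨g, hg, (hr.eq_regular fun s hs j ↦ ?_).trans
      (BeamDist.regular_congr hf.locallyIntegrable hg.continuous.locallyIntegrable hgf)⟩
    exact (BeamDist.iterCoeff_add f c 0 4 s j).symm.trans (h s hs (j + 4) (by omega))
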